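/- Let $K$ be a field of characteristic $0$. Let $\mu$ be a partition of $n$, with cells written as pairs $(i,j)$ counted from $0$: $i\ge 0$ is the row and $0\le j<\mu_{i+1}$ is the position in that row. Let $(p_1,q_1),\dots,(p_n,q_n)$ be the cells of $\mu$ in lexicographic order and put $$\Delta_\mu(x,y)=\det\big\|x_i^{p_j}y_i^{q_j}\big\|_{i,j=1}^n\in K[x_1,\dots,x_n,y_1,\dots,y_n].$$ Let $\mathbf M_\mu$ be the $K$-linear span of all partial derivatives (of all orders, including order $0$) of $\Delta_\mu$. The $n!$ conjecture for $\mu$ is the assertion $\dim\mathbf M_\mu=n!$. The group $S_n$ acts on $\mathbf M_\mu$ diagonally, $x_i\mapsto x_{\sigma_i}$, $y_i\mapsto y_{\sigma_i}$. Let $\mathcal H_{h,k}(\mathbf M_\mu)$ be the $S_n$-invariant subspace of the elements of $\mathbf M_\mu$ that are bihomogeneous of degree $h$ in $x$ and $k$ in $y$; it vanishes unless $h\le n(\mu)=\sum_{(i,j)\in\mu}i$ and $k\le n(\mu')=\sum_{(i,j)\in\mu}j$. Let $$C_\mu(x;q,t)=\frac1{n!}\sum_{\sigma\in S_n}\Big(\sum_{h,k}t^hq^k\,\operatorname{char}\mathcal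 H_{h,k}(\mathbf M_\mu)(\sigma)\Big)p_{\lambda(\sigma)}$$ be the bivariate Frobenius characteristic, where $\lambda(\sigma)$ is the cycle type of $\sigma$ and $p_\lambda$ is the power-sum symmetric function. Let $\partial_{p_1}$ be the partial derivative with respect to $p_1$ of symmetric functions written as polynomials in the power sums $p_1,p_2,\dots$. Put $G_\mu(q,t)=\partial_{p_1}^n C_\mu(x;q,t)$, let $\operatorname{Hilb}_\mu(q,t)=\sum_{h,k}t^hq^k\dim\mathcal H_{h,k}(\mathbf M_\mu)$ be the bigraded Hilbert series of $\mathbf M_\mu$, and let $B_\mu(q,t)=\sum_{(i,j)\in\mu}t^iq^j$. **Theorem 1.1.** Let $r,s\ge1$, let $r^s$ be the partition with $s$ parts equal to $r$, and let $(r-1,r^{s-1})$ be the partition with $s-1$ parts equal to $r$ and one part equal to $r-1$ (omitted if $r=1$). If the $n!$ conjecture holds for $(r-1,r^{s-1})$, then it holds for $r^s$, and moreover $$\partial_{p_1}C_{r^s}(x;q,t)=B_{r^s}(q,t)\,C_{r-1,r^{s-1}}(x;q,t),$$ $$G_{r^s}(q,t)=B_{r^s}(q,t)\,G_{r-1,r^{s-1}}(q,t),\qquad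 \operatorname{Hilb}_{r^s}(q,t)=B_{r^s}(q,t)\,\operatorname{Hilb}_{r-1,r^{s-1}}(q,t).$$ -/

import Mathlib

namespace GarsiaHaiman

/-! Partitions are Young diagrams. The cell `(i, j) ∈ μ`, counted from `0`, lies in row `i`, at
position `j` of that row, so it is the biexponent `(i, j)` of `μ`; there are `μ.card = n` of
them. -/

/-- The rectangular partition `r^s`, with `s` parts equal to `r`. -/
def rect (r s : ℕ) : YoungDiagram :=
  YoungDiagram.ofRowLens (List.replicate s r) (List.pairwise_replicate_of_refl).sortedGE

theorem sortedGE_rectPred (r s : ℕ) :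
    (List.replicate (s - 1) r ++ [r - 1]).SortedGE := by
  refine List.Pairwise.sortedGE ?_
  rw [List.pairwise_append]
  refine ⟨List.pairwise_replicate_of_refl, List.pairwise_singleton _ _, ?_⟩
  intro a ha b hb
  have h1 := List.eq_of_mem_replicate ha
  have h2 := List.mem_singleton.mp hb
  omega

/-- The partition `(r - 1, r^{s-1})` for `r, s ≥ 1`: `s - 1` parts equal to `r` and one part equal
to `r - 1` (which disappears when `r = 1`). -/
def rectPred (r s : ℕ) : YoungDiagram :=
  YoungDiagram.ofRowLens (List.replicate (s - 1) r ++ [r - 1]) (sortedGE_rectPred r s)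

/-- `n(μ) = ∑ i`, summed over the cells `(i, j)` of `μ`: the degree of `Δ_μ` in the `x`'s. -/
def xDeg (μ : YoungDiagram) : ℕ := ∑ c ∈ μ.cells, c.1

/-- `n(μ') = ∑ j`, summed over the cells `(i, j)` of `μ`: the degree of `Δ_μ` in the `y`'s. -/
def yDeg (μ : YoungDiagram) : ℕ := ∑ c ∈ μ.cells, c.2

/-- The biexponents of `μ`, enumerated in lexicographic order. -/
def biexp (μ : YoungDiagram) (k : Fin μ.card) : ℕ × ℕ :=
  ofLex ((μ.cells.map toLex.toEmbedding).orderEmbOfFin (Finset.card_map _) k)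

/-- Index set of the variables: `Sum.inl i` is `x_i` and `Sum.inr i` is `y_i`. -/
abbrev Var (n : ℕ) : Type := Fin n ⊕ Fin n

/-- The bidegree of a variable: `(1, 0)` for `x_i` and `(0, 1)` for `y_i`. -/
def bideg {n : ℕ} : Var n → ℕ × ℕ := Sum.elim (fun _ => (1, 0)) (fun _ => (0, 1))

section Modules

variable (K : Type*) [Field K]

/-- `Δ_μ(x, y) = det ‖x_i ^ p_j * y_i ^ q_j‖`, where `(p_j, q_j)` is the `j`-th biexponent. -/
noncomputable def Delta (μ : YoungDiagram) : MvPolynomial (Var μ.card) K :=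
  (Matrix.of fun i j : Fin μ.card =>
    (MvPolynomial.X (Sum.inl i) ^ (biexp μ j).1 * MvPolynomial.X (Sum.inr i) ^ (biexp μ j).2 :
      MvPolynomial (Var μ.card) K)).det

variable {K} in
/-- The iterated partial derivative of `P` with respect to the variables in the list `l`. -/
noncomputable def iterPDeriv {n : ℕ} (l : List (Var n)) (P : MvPolynomial (Var n) K) :
    MvPolynomial (Var n) K :=
  l.foldr (fun v Q => MvPolynomial.pderiv v Q) P

/-- The Garsia–Haiman module `M_μ`: the linear span of all the partial derivatives, of all orders
(order `0` included), of `Δ_μ`. -/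
noncomputable def GHModule (μ : YoungDiagram) : Submodule K (MvPolynomial (Var μ.card) K) :=
  Submodule.span K (Set.range fun l : List (Var μ.card) => iterPDeriv l (Delta K μ))

/-- The `n!` conjecture for `μ`: `dim M_μ = n!`. -/
def NFactorialConjecture (μ : YoungDiagram) : Prop :=
  Module.finrank K (GHModule K μ) = μ.card.factorial

/-- The subspace `H_{h,k}(M_μ)` of the elements of `M_μ` that are bihomogeneous of degree `h` in
the `x`'s and of degree `k` in the `y`'s. -/
noncomputable def bihomPart (μ : YoungDiagram) (h k : ℕ) :
    Submodule K (MvPolynomial (Var μ.card) K) :=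
  GHModule K μ ⊓ MvPolynomial.weightedHomogeneousSubmodule K bideg (h, k)

/-- The diagonal action: `(σ P)(x_1, …, x_n; y_1, …, y_n) = P(x_{σ 1}, …, x_{σ n}; y_{σ 1}, …,
y_{σ n})`. -/
noncomputable def diagAction (n : ℕ) :
    Representation K (Equiv.Perm (Fin n)) (MvPolynomial (Var n) K) where
  toFun σ := (MvPolynomial.rename (R := K) (Sum.map σ σ : Var n → Var n)).toLinearMap
  map_one' := by
    refine LinearMap.ext fun P => ?_
    simp [MvPolynomial.rename_id]
  map_mul' σ τ := by
    refine LinearMap.ext fun P => ?_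
    simp [MvPolynomial.rename_rename]

theorem diagAction_apply {n : ℕ} (σ : Equiv.Perm (Fin n)) (P : MvPolynomial (Var n) K) :
    diagAction K n σ P = MvPolynomial.rename (Sum.map σ σ : Var n → Var n) P := rfl

theorem diagAction_iterPDeriv {n : ℕ} (σ : Equiv.Perm (Fin n)) (l : List (Var n))
    (P : MvPolynomial (Var n) K) :
    diagAction K n σ (iterPDeriv l P) =
      iterPDeriv (l.map (Sum.map σ σ)) (diagAction K n σ P) := by
  induction l with
  | nil => rfl
  | cons v l ih =>
    have hinj : Function.Injective (Sum.map σ σ : Var n → Var n) :=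
      Function.Injective.sumMap σ.injective σ.injective
    change diagAction K n σ (MvPolynomial.pderiv v (iterPDeriv l P)) =
      MvPolynomial.pderiv (Sum.map σ σ v) (iterPDeriv (l.map (Sum.map σ σ)) (diagAction K n σ P))
    rw [← ih, diagAction_apply, diagAction_apply, MvPolynomial.pderiv_rename hinj]

theorem diagAction_Delta (μ : YoungDiagram) (σ : Equiv.Perm (Fin μ.card)) :
    diagAction K μ.card σ (Delta K μ) = (Equiv.Perm.sign σ : ℤ) • Delta K μ := by
  rw [diagAction_apply, Delta, AlgHom.map_det, zsmul_eq_mul, ← Matrix.det_permute]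
  congr 1
  ext1 i j
  simp [Matrix.submatrix]

theorem diagAction_mem_GHModule (μ : YoungDiagram) (σ : Equiv.Perm (Fin μ.card))
    {P : MvPolynomial (Var μ.card) K} (hP : P ∈ GHModule K μ) :
    diagAction K μ.card σ P ∈ GHModule K μ := by
  have hle : GHModule K μ ≤ (GHModule K μ).comap (diagAction K μ.card σ) := by
    refine Submodule.span_le.mpr ?_
    rintro _ ⟨l, rfl⟩
    have hz : ∀ (l : List (Var μ.card)) (z : ℤ) (Q : MvPolynomial (Var μ.card) K),
        iterPDeriv l (z • Q) = z • iterPDeriv l Q := by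
      intro l z Q
      induction l with
      | nil => rfl
      | cons v l ih =>
        change MvPolynomial.pderiv v (iterPDeriv l (z • Q)) =
          z • MvPolynomial.pderiv v (iterPDeriv l Q)
        rw [ih, map_zsmul]
    change diagAction K μ.card σ (iterPDeriv l (Delta K μ)) ∈ GHModule K μ
    rw [diagAction_iterPDeriv, diagAction_Delta, hz]
    exact zsmul_mem (Submodule.subset_span (Set.mem_range_self _)) _
  exact hle hP

theorem diagAction_mem_weightedHomogeneous {n : ℕ} (σ : Equiv.Perm (Fin n)) (d : ℕ × ℕ)
    {P : MvPolynomial (Var n) K}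
    (hP : P ∈ MvPolynomial.weightedHomogeneousSubmodule K bideg d) :
    diagAction K n σ P ∈ MvPolynomial.weightedHomogeneousSubmodule K bideg d := by
  rw [MvPolynomial.mem_weightedHomogeneousSubmodule] at hP ⊢
  intro c hc
  rw [diagAction_apply] at hc
  obtain ⟨u, rfl, hu⟩ := MvPolynomial.coeff_rename_ne_zero _ _ _ hc
  rw [← hP hu]
  have hb : (bideg : Var n → ℕ × ℕ) ∘ Sum.map σ σ = bideg := by
    funext v; cases v <;> rfl
  simp only [Finsupp.weight_apply]
  rw [Finsupp.sum_mapDomain_index (by simp) (by intros; simp [add_smul])]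
  exact Finsupp.sum_congr fun v _ => by rw [← congrFun hb v]; rfl

/-- The `S_n`-module `H_{h,k}(M_μ)`, with the diagonal action. -/
noncomputable def bihomRep (μ : YoungDiagram) (h k : ℕ) :
    Representation K (Equiv.Perm (Fin μ.card)) (bihomPart K μ h k) :=
  (diagAction K μ.card).subrepresentation (bihomPart K μ h k) fun σ _ hP =>
    ⟨diagAction_mem_GHModule K μ σ hP.1, diagAction_mem_weightedHomogeneous K σ (h, k) hP.2⟩

end Modules

section Characteristics

variable (K : Type*) [Field K]

/-- The coefficient ring `K[q, t]`. -/
abbrev QT : Type _ := MvPolynomial (Fin 2) K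

noncomputable def q : QT K := MvPolynomial.X 0

noncomputable def t : QT K := MvPolynomial.X 1

/-- The ring of symmetric functions with coefficients in `K[q, t]`, for `K` of characteristic `0`,
as the polynomial ring `K[q, t][p_1, p_2, p_3, …]` in the power sums. -/
abbrev SymFun : Type _ := MvPolynomial ℕ+ (QT K)

/-- The power sum `p_k`, for `k ≥ 1`. -/
noncomputable def p (k : ℕ) : SymFun K := MvPolynomial.X k.toPNat'

/-- The partial derivative of a symmetric function with respect to `p_1`, as a polynomial in the
power sums. -/
noncomputable def dp1 (f : SymFun K) : SymFun K := MvPolynomial.pderiv (1 : ℕ+) f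

/-- `p_{λ(σ)}`, where `λ(σ)` is the cycle structure of `σ`, fixed points included. -/
noncomputable def pShape {n : ℕ} (σ : Equiv.Perm (Fin n)) : SymFun K :=
  (σ.partition.parts.map (p K)).prod

/-- The bigraded character of `M_μ` at `σ`: the sum over `h ≤ n(μ)` and `k ≤ n(μ')` of
`t^h q^k char H_{h,k}(M_μ) (σ)`. -/
noncomputable def bigradedChar (μ : YoungDiagram) (σ : Equiv.Perm (Fin μ.card)) : QT K :=
  ∑ h ∈ Finset.range (xDeg μ + 1), ∑ k ∈ Finset.range (yDeg μ + 1),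
    (bihomRep K μ h k).character σ • (t K ^ h * q K ^ k)

/-- The bivariate Frobenius characteristic `C_μ(x; q, t)` of `M_μ`. -/
noncomputable def frobChar (μ : YoungDiagram) : SymFun K :=
  ((μ.card.factorial : K)⁻¹) •
    ∑ σ : Equiv.Perm (Fin μ.card), bigradedChar K μ σ • pShape K σ

/-- `G_μ(q, t) = ∂_{p_1}^n C_μ(x; q, t)`. As `C_μ` is homogeneous of degree `n`, this is an element
of `K[q, t]`; it is read off here as the constant term. -/
noncomputable def G (μ : YoungDiagram) : QT K :=
  MvPolynomial.constantCoeff ((dp1 K)^[μ.card] (frobChar K μ))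

/-- The bigraded Hilbert series of `M_μ`. -/
noncomputable def hilbertSeries (μ : YoungDiagram) : QT K :=
  ∑ h ∈ Finset.range (xDeg μ + 1), ∑ k ∈ Finset.range (yDeg μ + 1),
    (Module.finrank K (bihomPart K μ h k) : QT K) * (t K ^ h * q K ^ k)

/-- The biexponent generator `B_μ(q, t) = ∑ t^i q^j`, summed over the cells `(i, j)` of `μ`. -/
noncomputable def B (μ : YoungDiagram) : QT K :=
  ∑ c ∈ μ.cells, t K ^ c.1 * q K ^ c.2

end Characteristics

end GarsiaHaiman

namespace GarsiaHaiman

/-! ### Lattice determinants and the bound `n!` for the span of their derivatives. -/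

section LatticeModules

variable {K : Type*} [Field K] {n : ℕ}

/-! ### Iterated partial derivatives -/

/-! Let `D` list the cells of the rectangle without its corner `(s - 1, r - 1)`, and let `D'` be `D`
followed by the corner, with `n + 1 = s * r` cells. The theorem comes from squeezing `dim M_{D'}`
between two bounds.

Upper bound. For a lower set of `N` cells, `dim M ≤ N!` (`finite_latticeModule_and_finrank_le`).
Evaluate monomials on the `N!` rearrangements of the list of cells. Forward differences at `0` send
`x ^ a` to `0` if `a < d` and to `d!` if `a = d`, so up to the degree of `Δ` the constant term of
`∂^m Δ` is a fixed linear functional of the values of the monomial `m` on this orbit. A relation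
between values therefore gives, in top degree, a relation between derivatives of `Δ`, and
independent derivatives have independent value vectors in a space of dimension `N!`.

Lower bound. Expand the elements of `M_{D'}` in the last pair of variables, and filter by the last
cell, read row by row, with nonzero coefficient. Differentiating `Δ_{D'}` in the last pair moves the
corner to any cell `(a, b)` of the rectangle and leaves a nonzero multiple of `Δ_D` as leading
coefficient. So each of the `n + 1` graded pieces contains `M_D` (`latticeModule_le_map_flag`). If
`dim M_D = n!`, the bounds meet: `dim M_{D'} = (n + 1)!` and every piece equals `M_D`.

The filtration is stable under the permutations fixing the last index, and the piece at `(a, b)` is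
`M_D` with bidegree shifted by `(a, b)`. Hence the restriction to `S_n` of the bigraded character of
`M_{D'}` is `B` times that of `M_D` (`latticeChar_fixPerm`). On Frobenius characteristics
restriction is `∂_{p_1}` (`dp1_frobenius`); iterating gives the formula for `G`, and the value at
the identity gives the Hilbert series. -/

variable (K) in
/-- `iterPDeriv l` as a linear map. -/
noncomputable def iterPDerivLin (l : List (Var n)) :
    MvPolynomial (Var n) K →ₗ[K] MvPolynomial (Var n) K :=
  l.foldr (fun v f => (MvPolynomial.pderiv v).toLinearMap ∘ₗ f) LinearMap.id

theorem iterPDerivLin_apply (l : List (Var n)) (P : MvPolynomial (Var n) K) :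
    iterPDerivLin K l P = iterPDeriv l P := by
  induction l with
  | nil => rfl
  | cons v l ih =>
    change MvPolynomial.pderiv v (iterPDerivLin K l P) = MvPolynomial.pderiv v (iterPDeriv l P)
    rw [ih]

theorem iterPDeriv_cons (v : Var n) (l : List (Var n)) (P : MvPolynomial (Var n) K) :
    iterPDeriv (v :: l) P = MvPolynomial.pderiv v (iterPDeriv l P) := rfl

theorem iterPDeriv_append (l l' : List (Var n)) (P : MvPolynomial (Var n) K) :
    iterPDeriv (l ++ l') P = iterPDeriv l (iterPDeriv l' P) :=
  List.foldr_append

/-- The commutator of two derivations is a derivation, and here it kills every variable. -/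
theorem pderiv_pderiv_comm (v w : Var n) (P : MvPolynomial (Var n) K) :
    MvPolynomial.pderiv v (MvPolynomial.pderiv w P) =
      MvPolynomial.pderiv w (MvPolynomial.pderiv v P) := by
  have h : ⁅(MvPolynomial.pderiv v : Derivation K (MvPolynomial (Var n) K) (MvPolynomial (Var n) K)),
      (MvPolynomial.pderiv w : Derivation K (MvPolynomial (Var n) K) (MvPolynomial (Var n) K))⁆ = 0 := by
    refine MvPolynomial.derivation_ext fun u => ?_
    classical
    rw [Derivation.commutator_apply, MvPolynomial.pderiv_X, MvPolynomial.pderiv_X]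
    simp only [Pi.single_apply]
    split_ifs <;> simp
  have := congrArg (fun d => d P) h
  simpa [Derivation.commutator_apply, sub_eq_zero] using this

theorem iterPDeriv_pderiv (v : Var n) (l : List (Var n)) (P : MvPolynomial (Var n) K) :
    iterPDeriv l (MvPolynomial.pderiv v P) = MvPolynomial.pderiv v (iterPDeriv l P) := by
  induction l with
  | nil => rfl
  | cons w l ih => rw [iterPDeriv_cons, ih, iterPDeriv_cons, pderiv_pderiv_comm]

/-- The exponent vector of the monomial `∏_{v ∈ l} v`. -/
noncomputable def listExp (l : List (Var n)) : Var n →₀ ℕ :=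
  (l.map fun v => Finsupp.single v 1).sum

theorem listExp_cons (v : Var n) (l : List (Var n)) :
    listExp (v :: l) = Finsupp.single v 1 + listExp l := by simp [listExp]

theorem listExp_append (l l' : List (Var n)) : listExp (l ++ l') = listExp l + listExp l' := by
  simp [listExp]

theorem sum_listExp (l : List (Var n)) : ∑ v, listExp l v = l.length := by
  induction l with
  | nil => simp [listExp]
  | cons v l ih =>
    rw [listExp_cons]
    simp only [Finsupp.add_apply, Finset.sum_add_distrib, ih, List.length_cons]
    rw [Finset.sum_eq_single v] <;> simp +contextual [eq_comm, add_comm]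

theorem exists_listExp (m : Var n →₀ ℕ) : ∃ l : List (Var n), listExp l = m := by
  induction m using Finsupp.induction_linear with
  | zero => exact ⟨[], rfl⟩
  | add f g hf hg =>
    obtain ⟨l, rfl⟩ := hf
    obtain ⟨l', rfl⟩ := hg
    exact ⟨l ++ l', listExp_append _ _⟩
  | single a b =>
    refine ⟨List.replicate b a, ?_⟩
    simp [listExp]

theorem constantCoeff_iterPDeriv (l : List (Var n)) (P : MvPolynomial (Var n) K) :
    MvPolynomial.constantCoeff (iterPDeriv l P) =
      (∏ v, ((listExp l v).factorial : K)) * MvPolynomial.coeff (listExp l) P := by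
  induction l generalizing P with
  | nil => simp [listExp, iterPDeriv, MvPolynomial.constantCoeff_eq]
  | cons v l ih =>
    rw [iterPDeriv_cons, ← iterPDeriv_pderiv, ih, MvPolynomial.coeff_pderiv, listExp_cons,
      add_comm (Finsupp.single v 1)]
    rw [← Finset.mul_prod_erase _ _ (Finset.mem_univ v),
      ← Finset.mul_prod_erase Finset.univ (fun w => (((listExp l + Finsupp.single v 1 :
        Var n →₀ ℕ) w).factorial : K)) (Finset.mem_univ v)]
    have h : ∀ w ∈ Finset.univ.erase v, (((listExp l + Finsupp.single v 1 :
        Var n →₀ ℕ) w).factorial : K) = ((listExp l w).factorial : K) := by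
      intro w hw
      rw [Finsupp.add_apply, Finsupp.single_eq_of_ne (Finset.ne_of_mem_erase hw), add_zero]
    rw [Finset.prod_congr rfl h]
    simp only [Finsupp.add_apply, Finsupp.single_eq_same, Nat.factorial_succ]
    push_cast
    ring

/-- Up to factorials, invertible in characteristic `0`, these constant terms are the coefficients of
`P`. This is the test by which derivatives of `Δ` are shown to satisfy relations. -/
theorem eq_zero_of_constantCoeff_iterPDeriv [CharZero K] {P : MvPolynomial (Var n) K}
    (h : ∀ l, MvPolynomial.constantCoeff (iterPDeriv l P) = 0) : P = 0 := by
  ext m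
  obtain ⟨l, rfl⟩ := exists_listExp m
  have := h l
  rw [constantCoeff_iterPDeriv] at this
  refine (mul_eq_zero.mp this).resolve_left ?_
  exact Finset.prod_ne_zero_iff.mpr fun v _ => Nat.cast_ne_zero.mpr (Nat.factorial_ne_zero _)

/-! ### Lattice determinants and the modules of their derivatives -/

variable (K) in
/-- The lattice determinant `det ‖x_i ^ p_j * y_i ^ q_j‖` of a sequence `D` of biexponents. -/
noncomputable def latticeDet (D : Fin n → ℕ × ℕ) : MvPolynomial (Var n) K :=
  (Matrix.of fun i j : Fin n =>
    (MvPolynomial.X (Sum.inl i) ^ (D j).1 * MvPolynomial.X (Sum.inr i) ^ (D j).2 :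
      MvPolynomial (Var n) K)).det

variable (K) in
/-- The span of all the partial derivatives of the lattice determinant of `D`. -/
noncomputable def latticeModule (D : Fin n → ℕ × ℕ) : Submodule K (MvPolynomial (Var n) K) :=
  Submodule.span K (Set.range fun l : List (Var n) => iterPDeriv l (latticeDet K D))

theorem iterPDeriv_mem_latticeModule (D : Fin n → ℕ × ℕ) (l : List (Var n)) :
    iterPDeriv l (latticeDet K D) ∈ latticeModule K D :=
  Submodule.subset_span ⟨l, rfl⟩

theorem latticeDet_mem_latticeModule (D : Fin n → ℕ × ℕ) : latticeDet K D ∈ latticeModule K D :=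
  iterPDeriv_mem_latticeModule D []

theorem iterPDeriv_mem_latticeModule_of_mem (D : Fin n → ℕ × ℕ) (l : List (Var n))
    {P : MvPolynomial (Var n) K} (hP : P ∈ latticeModule K D) :
    iterPDeriv l P ∈ latticeModule K D := by
  rw [← iterPDerivLin_apply]
  revert P
  change latticeModule K D ≤ (latticeModule K D).comap (iterPDerivLin K l)
  refine Submodule.span_le.mpr ?_
  rintro _ ⟨l', rfl⟩
  change iterPDerivLin K l (iterPDeriv l' (latticeDet K D)) ∈ latticeModule K D
  rw [iterPDerivLin_apply, ← iterPDeriv_append]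
  exact iterPDeriv_mem_latticeModule _ _

/-- The exponent vector of `∏ i, x_i ^ p_{σ i} * y_i ^ q_{σ i}`. -/
noncomputable def permExp (D : Fin n → ℕ × ℕ) (σ : Equiv.Perm (Fin n)) : Var n →₀ ℕ :=
  Finsupp.equivFunOnFinite.symm (Sum.elim (fun i => (D (σ i)).1) (fun i => (D (σ i)).2))

@[simp] theorem permExp_inl (D : Fin n → ℕ × ℕ) (σ : Equiv.Perm (Fin n)) (i : Fin n) :
    permExp D σ (Sum.inl i) = (D (σ i)).1 := rfl

@[simp] theorem permExp_inr (D : Fin n → ℕ × ℕ) (σ : Equiv.Perm (Fin n)) (i : Fin n) :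
    permExp D σ (Sum.inr i) = (D (σ i)).2 := rfl

theorem sum_permExp (D : Fin n → ℕ × ℕ) (σ : Equiv.Perm (Fin n)) :
    ∑ v, permExp D σ v = ∑ i, ((D i).1 + (D i).2) := by
  rw [Fintype.sum_sum_type, ← Finset.sum_add_distrib]
  exact Equiv.sum_comp σ fun i => (D i).1 + (D i).2

theorem latticeDet_eq_sum (D : Fin n → ℕ × ℕ) :
    latticeDet K D = ∑ σ : Equiv.Perm (Fin n),
      MvPolynomial.monomial (permExp D σ) ((Equiv.Perm.sign σ : ℤ) : K) := by
  rw [latticeDet, ← Matrix.det_transpose, Matrix.det_apply']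
  refine Finset.sum_congr rfl fun σ _ => ?_
  rw [MvPolynomial.monomial_eq, Finsupp.prod_fintype _ _ (by simp), Fintype.prod_sum_type,
    ← Finset.prod_mul_distrib]
  simp

theorem coeff_latticeDet (D : Fin n → ℕ × ℕ) (m : Var n →₀ ℕ) :
    MvPolynomial.coeff m (latticeDet K D) = ∑ σ : Equiv.Perm (Fin n),
      if permExp D σ = m then ((Equiv.Perm.sign σ : ℤ) : K) else 0 := by
  classical
  rw [latticeDet_eq_sum, MvPolynomial.coeff_sum]
  simp only [MvPolynomial.coeff_monomial]

theorem exists_permExp_of_coeff_ne_zero {D : Fin n → ℕ × ℕ} {m : Var n →₀ ℕ}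
    (h : MvPolynomial.coeff m (latticeDet K D) ≠ 0) : ∃ σ, permExp D σ = m := by
  by_contra! hn
  exact h (by rw [coeff_latticeDet, Finset.sum_eq_zero fun σ _ => if_neg (hn σ)])

/-! ### The upper bound `dim M_D ≤ n!` -/

/-- The value at `0` of the `d`-th forward difference of `x ^ a`. -/
def diffPow (K : Type*) [Field K] (d a : ℕ) : K :=
  ∑ k ∈ Finset.range (d + 1), ((-1) ^ (d - k) * d.choose k : ℤ) • (k : K) ^ a

theorem diffPow_eq (d a : ℕ) : diffPow K d a = (fwdDiff 1)^[d] (fun x : K => x ^ a) 0 := by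
  rw [fwdDiff_iter_eq_sum_shift]
  simp [diffPow]

theorem diffPow_of_lt {d a : ℕ} (h : a < d) : diffPow K d a = 0 := by
  rw [diffPow_eq, fwdDiff_iter_pow_eq_zero_of_lt h]; rfl

theorem diffPow_self (d : ℕ) : diffPow K d d = (d.factorial : K) := by
  rw [diffPow_eq, fwdDiff_iter_eq_factorial]; rfl

/-- The value of the monomial with exponent vector `m` at the point of the orbit of the biexponents
indexed by `σ`. -/
def orbitEval (K : Type*) [Field K] (D : Fin n → ℕ × ℕ) (m : Var n →₀ ℕ)
    (σ : Equiv.Perm (Fin n)) : K :=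
  ∏ i, ((D (σ i)).1 : K) ^ m (Sum.inl i) * ((D (σ i)).2 : K) ^ m (Sum.inr i)

theorem orbitEval_add (D : Fin n → ℕ × ℕ) (m m' : Var n →₀ ℕ) (σ : Equiv.Perm (Fin n)) :
    orbitEval K D (m + m') σ = orbitEval K D m σ * orbitEval K D m' σ := by
  rw [orbitEval, orbitEval, orbitEval, ← Finset.prod_mul_distrib]
  refine Finset.prod_congr rfl fun i _ => ?_
  simp only [Finsupp.add_apply, pow_add]
  ring

/-- Column operations turning evaluations on the biexponents into forward differences. -/
def diffMatrix (K : Type*) [Field K] (D : Fin n → ℕ × ℕ) : Matrix (Fin n) (Fin n) K :=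
  Matrix.of fun k j => (((-1) ^ ((D j).1 - (D k).1) * (D j).1.choose (D k).1 : ℤ) : K) *
    (((-1) ^ ((D j).2 - (D k).2) * (D j).2.choose (D k).2 : ℤ) : K)

/-- The mixed difference of orders `D j` at the origin only involves points of the box below `D j`.
The box lies in the lower set, and outside it the binomial coefficients vanish. -/
theorem sum_mul_diffMatrix {D : Fin n → ℕ × ℕ} (hinj : Function.Injective D)
    (hlow : IsLowerSet (Set.range D)) (a b : ℕ) (j : Fin n) :
    ∑ k, ((D k).1 : K) ^ a * ((D k).2 : K) ^ b * diffMatrix K D k j =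
      diffPow K (D j).1 a * diffPow K (D j).2 b := by
  classical
  rw [diffPow, diffPow, Finset.sum_mul_sum, ← Finset.sum_product']
  set F : ℕ × ℕ → K := fun c => (c.1 : K) ^ a * (c.2 : K) ^ b *
    ((((-1) ^ ((D j).1 - c.1) * (D j).1.choose c.1 : ℤ) : K) *
    (((-1) ^ ((D j).2 - c.2) * (D j).2.choose c.2 : ℤ) : K)) with hF
  have h1 : ∑ k, ((D k).1 : K) ^ a * ((D k).2 : K) ^ b * diffMatrix K D k j =
      ∑ c ∈ Finset.univ.image D, F c := by
    rw [Finset.sum_image fun x _ y _ h => hinj h]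
    rfl
  rw [h1]
  symm
  refine (Finset.sum_congr rfl fun c _ => ?_).trans
    (Finset.sum_subset (f := F) (s₁ := Finset.range ((D j).1 + 1) ×ˢ Finset.range ((D j).2 + 1))
      ?_ ?_)
  · simp only [hF, zsmul_eq_mul]
    ring
  · intro c hc
    rw [Finset.mem_product, Finset.mem_range, Finset.mem_range] at hc
    have : c ∈ Set.range D :=
      hlow (a := D j) ⟨Nat.lt_succ_iff.mp hc.1, Nat.lt_succ_iff.mp hc.2⟩ ⟨j, rfl⟩
    simpa using this
  · intro c _ hc
    rw [Finset.mem_product, Finset.mem_range, Finset.mem_range, not_and_or] at hc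
    simp only [hF]
    rcases hc with hc | hc
    · rw [Nat.choose_eq_zero_of_lt (by omega : (D j).1 < c.1)]; simp
    · rw [Nat.choose_eq_zero_of_lt (by omega : (D j).2 < c.2)]; simp

theorem sum_sign_orbitEval_mul_det {D : Fin n → ℕ × ℕ} (hinj : Function.Injective D)
    (hlow : IsLowerSet (Set.range D)) (m : Var n →₀ ℕ) :
    (∑ σ : Equiv.Perm (Fin n), ((Equiv.Perm.sign σ : ℤ) : K) * orbitEval K D m σ) *
        (diffMatrix K D).det =
      ∑ σ : Equiv.Perm (Fin n), ((Equiv.Perm.sign σ : ℤ) : K) *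
        ∏ i, diffPow K (D (σ i)).1 (m (Sum.inl i)) * diffPow K (D (σ i)).2 (m (Sum.inr i)) := by
  have h1 : ∑ σ : Equiv.Perm (Fin n), ((Equiv.Perm.sign σ : ℤ) : K) * orbitEval K D m σ =
      (Matrix.of fun i k => ((D k).1 : K) ^ m (Sum.inl i) * ((D k).2 : K) ^ m (Sum.inr i)).det := by
    rw [← Matrix.det_transpose, Matrix.det_apply']
    rfl
  rw [h1, ← Matrix.det_mul, ← Matrix.det_transpose, Matrix.det_apply']
  refine Finset.sum_congr rfl fun σ _ => ?_
  congr 1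
  refine Finset.prod_congr rfl fun i _ => ?_
  rw [Matrix.transpose_apply, Matrix.mul_apply, ← sum_mul_diffMatrix hinj hlow]
  rfl

/-- In degree at most that of `Δ`, an exponent vector either equals that of a given term of `Δ` or
is smaller in some variable. In the first case the differences produce exactly the factorials of the
derivative, in the second one of them vanishes. The determinant of `diffMatrix` enters only as a
constant factor, so its nonvanishing plays no role. -/
theorem constantCoeff_iterPDeriv_latticeDet {D : Fin n → ℕ × ℕ} (hinj : Function.Injective D)
    (hlow : IsLowerSet (Set.range D)) (l : List (Var n))
    (hl : l.length ≤ ∑ i, ((D i).1 + (D i).2)) :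
    MvPolynomial.constantCoeff (iterPDeriv l (latticeDet K D)) =
      (∑ σ : Equiv.Perm (Fin n), ((Equiv.Perm.sign σ : ℤ) : K) * orbitEval K D (listExp l) σ) *
        (diffMatrix K D).det := by
  rw [sum_sign_orbitEval_mul_det hinj hlow, constantCoeff_iterPDeriv, coeff_latticeDet,
    Finset.mul_sum]
  refine Finset.sum_congr rfl fun σ _ => ?_
  have hprod : ∏ i, diffPow K (D (σ i)).1 (listExp l (Sum.inl i)) *
      diffPow K (D (σ i)).2 (listExp l (Sum.inr i)) =
      ∏ v, diffPow K (permExp D σ v) (listExp l v) := by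
    rw [Fintype.prod_sum_type, ← Finset.prod_mul_distrib]
    rfl
  rw [hprod]
  split_ifs with h
  · rw [← h]
    simp only [diffPow_self]
    ring
  · have : ∃ v, listExp l v < permExp D σ v := by
      by_contra! hle
      have hsum : ∑ v, permExp D σ v = ∑ v, listExp l v :=
        le_antisymm (Finset.sum_le_sum fun v _ => hle v)
          (by rw [sum_listExp, sum_permExp]; exact hl)
      exact h (Finsupp.ext fun v =>
        (Finset.sum_eq_sum_iff_of_le fun v _ => hle v).mp hsum v (Finset.mem_univ v))
    obtain ⟨v, hv⟩ := this
    rw [mul_zero, Finset.prod_eq_zero (f := fun v => diffPow K (permExp D σ v) (listExp l v))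
      (Finset.mem_univ v) (diffPow_of_lt hv), mul_zero]

/-- A linear relation between the evaluations of some monomials on the orbit of the biexponents
yields a linear relation, among those of top degree, between the corresponding derivatives. -/
theorem sum_top_iterPDeriv_eq_zero [CharZero K] {D : Fin n → ℕ × ℕ}
    (hinj : Function.Injective D) (hlow : IsLowerSet (Set.range D)) {ι : Type*} (s : Finset ι)
    (l : ι → List (Var n)) (c : ι → K) (e : ℕ) (he : ∀ i ∈ s, (l i).length ≤ e)
    (hc : ∑ i ∈ s, c i • orbitEval K D (listExp (l i)) = 0) :
    ∑ i ∈ s with (l i).length = e, c i • iterPDeriv (l i) (latticeDet K D) = 0 := by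
  refine eq_zero_of_constantCoeff_iterPDeriv fun l' => ?_
  rw [← iterPDerivLin_apply, map_sum, map_sum]
  simp only [map_smul, iterPDerivLin_apply, ← iterPDeriv_append, MvPolynomial.constantCoeff_smul,
    smul_eq_mul]
  rcases eq_or_ne (l'.length + e) (∑ i, ((D i).1 + (D i).2)) with hd | hd
  -- `Δ` is homogeneous, so the derivatives of order below its degree have zero constant term and
  -- the shorter lists may be put back into the sum.
  · have hall : ∑ i ∈ s with (l i).length = e,
        c i * MvPolynomial.constantCoeff (iterPDeriv (l' ++ l i) (latticeDet K D)) =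
        ∑ i ∈ s, c i * MvPolynomial.constantCoeff (iterPDeriv (l' ++ l i) (latticeDet K D)) := by
      refine Finset.sum_subset (Finset.filter_subset _ _) fun i hi hne => ?_
      have hlt : (l i).length < e :=
        lt_of_le_of_ne (he i hi) fun h => hne (Finset.mem_filter.mpr ⟨hi, h⟩)
      rw [constantCoeff_iterPDeriv]
      by_cases h0 : MvPolynomial.coeff (listExp (l' ++ l i)) (latticeDet K D) = 0
      · rw [h0, mul_zero, mul_zero]
      · obtain ⟨σ, hσ⟩ := exists_permExp_of_coeff_ne_zero h0
        have := sum_permExp D σ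
        rw [hσ, sum_listExp, List.length_append] at this
        omega
    rw [hall]
    -- Evaluation is multiplicative: the values of the monomial of `l'` factor out, and what remains
    -- is the given relation `hc`.
    have hrw : ∀ i ∈ s,
        c i * MvPolynomial.constantCoeff (iterPDeriv (l' ++ l i) (latticeDet K D)) =
        ∑ σ : Equiv.Perm (Fin n), ((Equiv.Perm.sign σ : ℤ) : K) *
          orbitEval K D (listExp l') σ * (diffMatrix K D).det *
          (c i • orbitEval K D (listExp (l i))) σ := by
      intro i hi
      rw [constantCoeff_iterPDeriv_latticeDet hinj hlow _
        (by rw [List.length_append]; have := he i hi; omega), Finset.sum_mul, Finset.mul_sum]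
      refine Finset.sum_congr rfl fun σ _ => ?_
      rw [listExp_append, orbitEval_add, Pi.smul_apply, smul_eq_mul]
      ring
    rw [Finset.sum_congr rfl hrw, Finset.sum_comm]
    refine Finset.sum_eq_zero fun σ _ => ?_
    rw [← Finset.mul_sum, ← Finset.sum_apply, hc, Pi.zero_apply, mul_zero]
  · refine Finset.sum_eq_zero fun i hi => ?_
    have hi' := (Finset.mem_filter.mp hi).2
    rw [constantCoeff_iterPDeriv]
    by_cases h0 : MvPolynomial.coeff (listExp (l' ++ l i)) (latticeDet K D) = 0
    · rw [h0, mul_zero, mul_zero]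
    · obtain ⟨σ, hσ⟩ := exists_permExp_of_coeff_ne_zero h0
      have := sum_permExp D σ
      rw [hσ, sum_listExp, List.length_append] at this
      omega

theorem linearIndependent_orbitEval [CharZero K] {D : Fin n → ℕ × ℕ}
    (hinj : Function.Injective D) (hlow : IsLowerSet (Set.range D)) {ι : Type*}
    (l : ι → List (Var n))
    (hl : LinearIndependent K fun i => iterPDeriv (l i) (latticeDet K D)) :
    LinearIndependent K fun i => orbitEval K D (listExp (l i)) := by
  classical
  rw [linearIndependent_iff']
  intro s c hc i hi
  by_contra hne
  set s' := s.filter fun i => c i ≠ 0 with hs'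
  have hi' : i ∈ s' := Finset.mem_filter.mpr ⟨hi, hne⟩
  -- A longest list with nonzero coefficient survives in the top-degree relation, which contradicts
  -- independence of the derivatives.
  obtain ⟨k, hk, hmax⟩ := Finset.exists_max_image s' (fun i => (l i).length) ⟨i, hi'⟩
  have hc' : ∑ i ∈ s', c i • orbitEval K D (listExp (l i)) = 0 := by
    rw [← hc]
    refine Finset.sum_subset (Finset.filter_subset _ _) fun j hj hj' => ?_
    have : c j = 0 := by
      by_contra h
      exact hj' (Finset.mem_filter.mpr ⟨hj, h⟩)
    rw [this, zero_smul]
  have h0 := sum_top_iterPDeriv_eq_zero hinj hlow s' l c _ hmax hc'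
  have := linearIndependent_iff'.mp hl _ c h0 k (Finset.mem_filter.mpr ⟨hk, rfl⟩)
  exact (Finset.mem_filter.mp hk).2 this

theorem finite_latticeModule_and_finrank_le [CharZero K] {D : Fin n → ℕ × ℕ}
    (hinj : Function.Injective D) (hlow : IsLowerSet (Set.range D)) :
    Module.Finite K (latticeModule K D) ∧
      Module.finrank K (latticeModule K D) ≤ n.factorial := by
  classical
  obtain ⟨b, hb, hspan, hli⟩ := exists_linearIndependent K
    (Set.range fun l : List (Var n) => iterPDeriv l (latticeDet K D))
  choose l hl using fun x : b => hb x.2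
  have hli' : LinearIndependent K fun x : b => iterPDeriv (l x) (latticeDet K D) := by
    simpa only [hl] using hli
  have hli'' := linearIndependent_orbitEval hinj hlow l hli'
  have := hli''.finite
  have := Fintype.ofFinite b
  have hcard : Fintype.card b ≤ n.factorial := by
    have := hli''.fintype_card_le_finrank
    rwa [Module.finrank_fintype_fun_eq_card, Fintype.card_perm, Fintype.card_fin] at this
  rw [latticeModule, ← hspan]
  refine ⟨Module.Finite.span_of_finite K b.toFinite, ?_⟩
  refine (finrank_span_le_card (R := K) b).trans ?_
  rwa [Set.toFinset_card]

end LatticeModules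

/-! ### Traces and dimensions along a finite filtration. -/

section StableTrace

variable {K : Type*} [Field K]

/-! ### Traces on filtered spaces -/

theorem trace_eq_add_of_exact {V W Q : Type*} [AddCommGroup V] [Module K V] [AddCommGroup W]
    [Module K W] [AddCommGroup Q] [Module K Q] [Module.Finite K V]
    (i : W →ₗ[K] V) (π : V →ₗ[K] Q) (hi : Function.Injective i) (hπ : Function.Surjective π)
    (hex : LinearMap.range i = LinearMap.ker π) (fV : V →ₗ[K] V) (fW : W →ₗ[K] W)
    (fQ : Q →ₗ[K] Q) (h1 : fV ∘ₗ i = i ∘ₗ fW) (h2 : π ∘ₗ fV = fQ ∘ₗ π) :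
    LinearMap.trace K V fV = LinearMap.trace K W fW + LinearMap.trace K Q fQ := by
  have : Module.Finite K W := Module.Finite.of_injective i hi
  have : Module.Finite K Q := Module.Finite.of_surjective π hπ
  obtain ⟨s, hs⟩ := π.exists_rightInverse_of_surjective (LinearMap.range_eq_top.mpr hπ)
  have hmem : ∀ v, (LinearMap.id - s ∘ₗ π : V →ₗ[K] V) v ∈ LinearMap.range i := by
    intro v
    rw [hex, LinearMap.mem_ker]
    have := LinearMap.congr_fun hs (π v)
    simp only [LinearMap.comp_apply, LinearMap.id_apply] at this
    simp [this]
  let r : V →ₗ[K] W := (LinearEquiv.ofInjective i hi).symm.toLinearMap ∘ₗ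
    (LinearMap.id - s ∘ₗ π).codRestrict _ hmem
  have hir : i ∘ₗ r = LinearMap.id - s ∘ₗ π := by
    ext v
    exact congrArg Subtype.val ((LinearEquiv.ofInjective i hi).apply_symm_apply ⟨_, hmem v⟩)
  have hri : r ∘ₗ i = LinearMap.id := by
    ext w
    apply hi
    have h3 := LinearMap.congr_fun hir (i w)
    have h4 : π (i w) = 0 := by
      rw [← LinearMap.mem_ker, ← hex]; exact ⟨w, rfl⟩
    simpa [h4] using h3
  -- With the section `s` and the retraction `r`, the identity of `V` is `i ∘ r + s ∘ π`; cyclicity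
  -- of the trace then moves each summand to `W` or `Q`.
  have hdec : fV = (fV ∘ₗ i) ∘ₗ r + (fV ∘ₗ s) ∘ₗ π := by
    rw [LinearMap.comp_assoc, hir, LinearMap.comp_assoc, ← LinearMap.comp_add]
    simp
  conv_lhs => rw [hdec]
  rw [map_add, LinearMap.trace_comp_comm' r (fV ∘ₗ i), LinearMap.trace_comp_comm' π (fV ∘ₗ s), h1,
    ← LinearMap.comp_assoc, hri, LinearMap.id_comp, ← LinearMap.comp_assoc, h2,
    LinearMap.comp_assoc, hs, LinearMap.comp_id]

variable {A U : Type*} [AddCommGroup A] [Module K A] [AddCommGroup U] [Module K U]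

open Classical in
/-- The trace of `f` on a submodule `V`, with value `0` if `V` is not stable under `f`. -/
noncomputable def trOn (V : Submodule K A) (f : A →ₗ[K] A) : K :=
  if h : V ≤ V.comap f then LinearMap.trace K V (f.restrict h) else 0

theorem trOn_eq {V : Submodule K A} {f : A →ₗ[K] A} (h : V ≤ V.comap f) :
    trOn V f = LinearMap.trace K V (f.restrict h) := dif_pos h

theorem trOn_bot (f : A →ₗ[K] A) : trOn (⊥ : Submodule K A) f = 0 := by
  rw [trOn_eq bot_le]
  rw [Subsingleton.elim (f.restrict _) 0, map_zero]

theorem trOn_id (V : Submodule K A) [Module.Finite K V] :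
    trOn V LinearMap.id = (Module.finrank K V : K) := by
  rw [trOn_eq (V := V) (f := LinearMap.id) le_rfl, ← LinearMap.trace_id]
  rfl

theorem map_le_comap_map {V : Submodule K A} {f : A →ₗ[K] A} (hV : V ≤ V.comap f)
    {c : A →ₗ[K] U} {g : U →ₗ[K] U} (hc : ∀ P, c (f P) = g (c P)) :
    V.map c ≤ (V.map c).comap g := by
  rintro _ ⟨P, hP, rfl⟩
  exact ⟨f P, hV hP, hc P⟩

/-- Additivity of the trace on the exact sequence `0 → V ∩ ker c → V → c(V) → 0`. -/
theorem trOn_eq_add {V : Submodule K A} [Module.Finite K V] {f : A →ₗ[K] A}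
    (hV : V ≤ V.comap f) {c : A →ₗ[K] U} {g : U →ₗ[K] U} (hc : ∀ P, c (f P) = g (c P)) :
    trOn V f = trOn (V ⊓ LinearMap.ker c) f + trOn (V.map c) g := by
  have hker : V ⊓ LinearMap.ker c ≤ (V ⊓ LinearMap.ker c).comap f := by
    intro P hP
    refine ⟨hV hP.1, ?_⟩
    change c (f P) = 0
    rw [hc, show c P = 0 from hP.2, map_zero]
  rw [trOn_eq hV, trOn_eq hker, trOn_eq (map_le_comap_map hV hc)]
  refine trace_eq_add_of_exact (Submodule.inclusion inf_le_left) (c.submoduleMap V)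
    (Submodule.inclusion_injective _) (c.submoduleMap_surjective V) ?_ _ _ _ ?_ ?_
  · ext P
    rw [Submodule.range_inclusion]
    simp only [Submodule.mem_comap, Submodule.subtype_apply, Submodule.mem_inf, P.2, true_and,
      LinearMap.mem_ker]
    rw [← Subtype.coe_inj]
    rfl
  · rfl
  · ext P
    exact hc P

/-- The elements of `V` killed by all the `c j` with `j ≥ m`. -/
def flag (V : Submodule K A) (c : ℕ → A →ₗ[K] U) (m : ℕ) : Submodule K A :=
  V ⊓ ⨅ j : Set.Ici m, LinearMap.ker (c j)

theorem mem_flag {V : Submodule K A} {c : ℕ → A →ₗ[K] U} {m : ℕ} {P : A} :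
    P ∈ flag V c m ↔ P ∈ V ∧ ∀ j, m ≤ j → c j P = 0 := by
  simp [flag, Submodule.mem_iInf]

theorem flag_le (V : Submodule K A) (c : ℕ → A →ₗ[K] U) (m : ℕ) : flag V c m ≤ V := inf_le_left

theorem flag_succ_inf_ker (V : Submodule K A) (c : ℕ → A →ₗ[K] U) (m : ℕ) :
    flag V c (m + 1) ⊓ LinearMap.ker (c m) = flag V c m := by
  ext P
  rw [Submodule.mem_inf, mem_flag, mem_flag, LinearMap.mem_ker, and_assoc]
  refine and_congr_right fun _ =>
    ⟨fun h j hj => ?_, fun h => ⟨fun j hj => h j (by omega), h m le_rfl⟩⟩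
  rcases hj.eq_or_lt with rfl | hj
  exacts [h.2, h.1 j hj]

/-- On step `m + 1` of the flag the kernel of `c m` is step `m`, so `trOn_eq_add` telescopes from
`⊥` up to `V`. -/
theorem trOn_eq_sum_flag {V : Submodule K A} [Module.Finite K V] {f : A →ₗ[K] A}
    (hV : V ≤ V.comap f) {c : ℕ → A →ₗ[K] U} {g : U →ₗ[K] U}
    (hc : ∀ j P, c j (f P) = g (c j P)) (L : ℕ) (htop : ∀ P ∈ V, ∀ j, L ≤ j → c j P = 0)
    (hbot : ∀ P ∈ V, (∀ j, c j P = 0) → P = 0) :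
    trOn V f = ∑ j ∈ Finset.range L, trOn ((flag V c (j + 1)).map (c j)) g := by
  have hfin : ∀ m, Module.Finite K (flag V c m) := fun m =>
    Module.Finite.of_injective _ (Submodule.inclusion_injective (flag_le V c m))
  have hst : ∀ m, flag V c m ≤ (flag V c m).comap f := by
    intro m P hP
    rw [Submodule.mem_comap]
    rw [mem_flag] at hP ⊢
    exact ⟨hV hP.1, fun j hj => by rw [hc, hP.2 j hj, map_zero]⟩
  have h0 : flag V c 0 = ⊥ := by
    rw [eq_bot_iff]
    intro P hP
    rw [mem_flag] at hP
    exact hbot P hP.1 fun j => hP.2 j (Nat.zero_le _)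
  have hL : flag V c L = V :=
    le_antisymm (flag_le V c L) fun P hP => mem_flag.mpr ⟨hP, htop P hP⟩
  have key : ∀ m, trOn (flag V c m) f =
      ∑ j ∈ Finset.range m, trOn ((flag V c (j + 1)).map (c j)) g := by
    intro m
    induction m with
    | zero => rw [h0, trOn_bot, Finset.sum_range_zero]
    | succ m ih =>
      have := hfin (m + 1)
      rw [Finset.sum_range_succ, ← ih, trOn_eq_add (hst (m + 1)) (hc m), flag_succ_inf_ker]
  rw [← key L, hL]

/-- The trace formula for the identity; characteristic `0` recovers the dimensions from their images
in `K`. -/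
theorem finrank_eq_sum_flag [CharZero K] {V : Submodule K A} [Module.Finite K V]
    {c : ℕ → A →ₗ[K] U} (L : ℕ) (htop : ∀ P ∈ V, ∀ j, L ≤ j → c j P = 0)
    (hbot : ∀ P ∈ V, (∀ j, c j P = 0) → P = 0) :
    Module.finrank K V =
      ∑ j ∈ Finset.range L, Module.finrank K ((flag V c (j + 1)).map (c j)) := by
  have h := trOn_eq_sum_flag (V := V) (f := LinearMap.id) (g := LinearMap.id) (c := c) le_rfl
    (fun _ _ => rfl) L htop hbot
  have hfin : ∀ m, Module.Finite K (flag V c m) := fun m =>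
    Module.Finite.of_injective _ (Submodule.inclusion_injective (flag_le V c m))
  rw [trOn_id, Finset.sum_congr rfl fun j _ => trOn_id ((flag V c (j + 1)).map (c j))] at h
  exact_mod_cast h

/-- If the images of a flag contain subspaces whose dimensions add up to that of the whole space,
then the images are these subspaces. -/
theorem map_flag_eq [CharZero K] {V : Submodule K A} [Module.Finite K V]
    {c : ℕ → A →ₗ[K] U} (L : ℕ) (htop : ∀ P ∈ V, ∀ j, L ≤ j → c j P = 0)
    (hbot : ∀ P ∈ V, (∀ j, c j P = 0) → P = 0) (W : Submodule K U)
    (hW : ∀ j < L, W ≤ (flag V c (j + 1)).map (c j))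
    (hdim : Module.finrank K V ≤ L * Module.finrank K W) :
    Module.finrank K V = L * Module.finrank K W ∧
      ∀ j < L, (flag V c (j + 1)).map (c j) = W := by
  have hfin : ∀ m, Module.Finite K (flag V c m) := fun m =>
    Module.Finite.of_injective _ (Submodule.inclusion_injective (flag_le V c m))
  have h := finrank_eq_sum_flag L htop hbot
  have hle : ∀ j ∈ Finset.range L,
      Module.finrank K W ≤ Module.finrank K ((flag V c (j + 1)).map (c j)) := fun j hj =>
    Submodule.finrank_mono (hW j (Finset.mem_range.mp hj))
  have hconst : ∑ j ∈ Finset.range L, Module.finrank K W = L * Module.finrank K W := by simp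
  have hsum : ∑ j ∈ Finset.range L, Module.finrank K W =
      ∑ j ∈ Finset.range L, Module.finrank K ((flag V c (j + 1)).map (c j)) :=
    le_antisymm (Finset.sum_le_sum hle) (by rw [← h, hconst]; exact hdim)
  refine ⟨by rw [h, ← hsum, hconst], fun j hj => ?_⟩
  refine (Submodule.eq_of_le_of_finrank_eq (hW j hj) ?_).symm
  exact (Finset.sum_eq_sum_iff_of_le hle).mp hsum j (Finset.mem_range.mpr hj)

end StableTrace

/-! ### Bidegree, the last pair of variables, and the stabilizer of the last index. -/

section LastVariables

variable {K : Type*} [Field K] {n : ℕ}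

/-! ### Bihomogeneous components -/

variable (K) in
/-- The elements of `M_D` that are bihomogeneous of bidegree `(h, k)`. -/
noncomputable def latticePart (D : Fin n → ℕ × ℕ) (d : ℕ × ℕ) :
    Submodule K (MvPolynomial (Var n) K) :=
  latticeModule K D ⊓ MvPolynomial.weightedHomogeneousSubmodule K bideg d

theorem weight_bideg (m : Var n →₀ ℕ) :
    Finsupp.weight bideg m = (∑ i, m (Sum.inl i), ∑ i, m (Sum.inr i)) := by
  rw [Finsupp.weight_apply, Finsupp.sum_fintype _ _ (by simp), Fintype.sum_sum_type]
  ext <;> simp [bideg, Prod.fst_sum, Prod.snd_sum]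

theorem isWeightedHomogeneous_pderiv {P : MvPolynomial (Var n) K} {d : ℕ × ℕ}
    (hP : MvPolynomial.IsWeightedHomogeneous bideg P d) (v : Var n) :
    MvPolynomial.IsWeightedHomogeneous bideg (MvPolynomial.pderiv v P) (d - bideg v) := by
  intro m hm
  rw [MvPolynomial.coeff_pderiv] at hm
  have h := hP (left_ne_zero_of_mul hm)
  rw [map_add, Finsupp.weight_single, one_smul] at h
  rw [← h, add_tsub_cancel_right]

theorem exists_isWeightedHomogeneous_iterPDeriv (D : Fin n → ℕ × ℕ) (l : List (Var n)) :
    ∃ d ≤ ∑ i, D i, MvPolynomial.IsWeightedHomogeneous bideg (iterPDeriv l (latticeDet K D)) d := by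
  induction l with
  | nil =>
    refine ⟨_, le_rfl, fun m hm => ?_⟩
    obtain ⟨σ, rfl⟩ := exists_permExp_of_coeff_ne_zero hm
    rw [weight_bideg]
    ext
    · simpa [Prod.fst_sum] using Equiv.sum_comp σ fun i => (D i).1
    · simpa [Prod.snd_sum] using Equiv.sum_comp σ fun i => (D i).2
  | cons v l ih =>
    obtain ⟨d, hd, h⟩ := ih
    exact ⟨d - bideg v, tsub_le_self.trans hd, isWeightedHomogeneous_pderiv h v⟩

/-- The spanning derivatives are themselves bihomogeneous, so the span is a bigraded subspace. -/
theorem weightedHomogeneousComponent_mem_latticePart {D : Fin n → ℕ × ℕ}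
    {P : MvPolynomial (Var n) K} (hP : P ∈ latticeModule K D) (d : ℕ × ℕ) :
    MvPolynomial.weightedHomogeneousComponent bideg d P ∈ latticePart K D d := by
  refine ⟨?_, MvPolynomial.weightedHomogeneousComponent_mem _ _ _⟩
  revert P
  change latticeModule K D ≤
    (latticeModule K D).comap (MvPolynomial.weightedHomogeneousComponent bideg d)
  refine Submodule.span_le.mpr ?_
  rintro _ ⟨l, rfl⟩
  obtain ⟨e, -, h⟩ := exists_isWeightedHomogeneous_iterPDeriv (K := K) D l
  change MvPolynomial.weightedHomogeneousComponent bideg d (iterPDeriv l (latticeDet K D)) ∈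
    latticeModule K D
  rw [MvPolynomial.weightedHomogeneousComponent_of_mem (n := e) h]
  split_ifs
  exacts [iterPDeriv_mem_latticeModule D l, zero_mem _]

theorem latticePart_eq_bot {D : Fin n → ℕ × ℕ} {d : ℕ × ℕ} (hd : ¬ d ≤ ∑ i, D i) :
    latticePart K D d = ⊥ := by
  rw [eq_bot_iff]
  intro P hP
  have h0 : latticeModule K D ≤
      LinearMap.ker (MvPolynomial.weightedHomogeneousComponent (R := K) bideg d) := by
    refine Submodule.span_le.mpr ?_
    rintro _ ⟨l, rfl⟩
    obtain ⟨e, he, h⟩ := exists_isWeightedHomogeneous_iterPDeriv (K := K) D l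
    exact h.weightedHomogeneousComponent_ne d fun h' => hd (h' ▸ he)
  have h1 := h0 hP.1
  rw [LinearMap.mem_ker, MvPolynomial.IsWeightedHomogeneous.weightedHomogeneousComponent_same hP.2]
    at h1
  exact h1

/-! ### Coefficients with respect to the last pair of variables -/

/-- The inclusion of the variables with the last pair `x_n`, `y_n` omitted. -/
def castVar : Var n → Var (n + 1) := Sum.map Fin.castSucc Fin.castSucc

/-- The exponent vector of `x_n ^ c.1 * y_n ^ c.2` times the monomial with exponent vector `m`. -/
noncomputable def snocExp (c : ℕ × ℕ) (m : Var n →₀ ℕ) : Var (n + 1) →₀ ℕ :=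
  Finsupp.equivFunOnFinite.symm (Sum.elim
    (Fin.snoc (α := fun _ => ℕ) (fun i => m (Sum.inl i)) c.1)
    (Fin.snoc (α := fun _ => ℕ) (fun i => m (Sum.inr i)) c.2))

@[simp] theorem snocExp_castVar (c : ℕ × ℕ) (m : Var n →₀ ℕ) (v : Var n) :
    snocExp c m (castVar v) = m v := by
  cases v <;> simp [snocExp, castVar]

@[simp] theorem snocExp_inl_last (c : ℕ × ℕ) (m : Var n →₀ ℕ) :
    snocExp c m (Sum.inl (Fin.last n)) = c.1 := by
  simp [snocExp]

@[simp] theorem snocExp_inr_last (c : ℕ × ℕ) (m : Var n →₀ ℕ) :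
    snocExp c m (Sum.inr (Fin.last n)) = c.2 := by
  simp [snocExp]

theorem exp_ext_last {m m' : Var (n + 1) →₀ ℕ} (h : ∀ v, m (castVar v) = m' (castVar v))
    (hl : m (Sum.inl (Fin.last n)) = m' (Sum.inl (Fin.last n)))
    (hr : m (Sum.inr (Fin.last n)) = m' (Sum.inr (Fin.last n))) : m = m' := by
  ext v
  rcases v with i | i
  · induction i using Fin.lastCases with
    | last => exact hl
    | cast i => exact h (Sum.inl i)
  · induction i using Fin.lastCases with
    | last => exact hr
    | cast i => exact h (Sum.inr i)

theorem snocExp_injective (c : ℕ × ℕ) : Function.Injective (snocExp c : (Var n →₀ ℕ) → _) := by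
  intro m m' h
  ext v
  rw [← snocExp_castVar c m, h, snocExp_castVar]

theorem castVar_injective : Function.Injective (castVar : Var n → Var (n + 1)) :=
  Function.Injective.sumMap (Fin.castSucc_injective n) (Fin.castSucc_injective n)

theorem exists_snocExp (m : Var (n + 1) →₀ ℕ) : ∃ m',
    snocExp (m (Sum.inl (Fin.last n)), m (Sum.inr (Fin.last n))) m' = m :=
  ⟨m.comapDomain castVar castVar_injective.injOn, exp_ext_last (by simp) (by simp) (by simp)⟩

theorem weight_snocExp (c : ℕ × ℕ) (m : Var n →₀ ℕ) :
    Finsupp.weight bideg (snocExp c m) = Finsupp.weight bideg m + c := by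
  rw [weight_bideg, weight_bideg, Fin.sum_univ_castSucc, Fin.sum_univ_castSucc]
  have h1 := fun i : Fin n => snocExp_castVar c m (Sum.inl i)
  have h2 := fun i : Fin n => snocExp_castVar c m (Sum.inr i)
  simp only [castVar, Sum.map_inl, Sum.map_inr] at h1 h2
  simp only [h1, h2, snocExp_inl_last, snocExp_inr_last]
  rfl

variable (K) in
/-- The coefficient of `x_n ^ c.1 * y_n ^ c.2`, a polynomial in the remaining variables. -/
noncomputable def coeffLast (c : ℕ × ℕ) :
    MvPolynomial (Var (n + 1)) K →ₗ[K] MvPolynomial (Var n) K :=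
  (AddMonoidAlgebra.coeffLinearEquiv K).symm.toLinearMap ∘ₗ
    Finsupp.lcomapDomain (snocExp c) (snocExp_injective c) ∘ₗ
      (AddMonoidAlgebra.coeffLinearEquiv K).toLinearMap

@[simp] theorem coeff_coeffLast (c : ℕ × ℕ) (m : Var n →₀ ℕ) (P : MvPolynomial (Var (n + 1)) K) :
    MvPolynomial.coeff m (coeffLast K c P) = MvPolynomial.coeff (snocExp c m) P := rfl

theorem eq_zero_of_coeffLast {P : MvPolynomial (Var (n + 1)) K}
    (h : ∀ c, coeffLast K c P = 0) : P = 0 := by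
  ext m
  obtain ⟨m', hm'⟩ := exists_snocExp m
  rw [← hm', ← coeff_coeffLast, h]
  rfl

theorem coeffLast_pderiv_castVar (c : ℕ × ℕ) (v : Var n) (P : MvPolynomial (Var (n + 1)) K) :
    coeffLast K c (MvPolynomial.pderiv (castVar v) P) =
      MvPolynomial.pderiv v (coeffLast K c P) := by
  ext m
  rw [coeff_coeffLast, MvPolynomial.coeff_pderiv, MvPolynomial.coeff_pderiv, coeff_coeffLast,
    snocExp_castVar]
  congr 2
  refine exp_ext_last (fun w => ?_) ?_ ?_
  · rw [Finsupp.add_apply, snocExp_castVar, snocExp_castVar, Finsupp.add_apply,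
      Finsupp.single_apply, Finsupp.single_apply]
    simp only [castVar_injective.eq_iff]
  · cases v <;> simp [castVar]
  · cases v <;> simp [castVar]

theorem coeffLast_iterPDeriv_castVar (c : ℕ × ℕ) (l : List (Var n))
    (P : MvPolynomial (Var (n + 1)) K) :
    coeffLast K c (iterPDeriv (l.map castVar) P) = iterPDeriv l (coeffLast K c P) := by
  induction l with
  | nil => rfl
  | cons v l ih =>
    rw [List.map_cons, iterPDeriv_cons, coeffLast_pderiv_castVar, ih, iterPDeriv_cons]

theorem coeffLast_pderiv_inl_last (c : ℕ × ℕ) (P : MvPolynomial (Var (n + 1)) K) :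
    coeffLast K c (MvPolynomial.pderiv (Sum.inl (Fin.last n)) P) =
      ((c.1 : K) + 1) • coeffLast K (c.1 + 1, c.2) P := by
  ext m
  rw [coeff_coeffLast, MvPolynomial.coeff_pderiv, MvPolynomial.coeff_smul, coeff_coeffLast,
    smul_eq_mul, mul_comm, snocExp_inl_last]
  congr 2
  refine exp_ext_last (fun w => ?_) ?_ ?_
  · cases w <;> simp [castVar, Fin.castSucc_ne_last] <;> simp [snocExp]
  · simp
  · simp

theorem coeffLast_pderiv_inr_last (c : ℕ × ℕ) (P : MvPolynomial (Var (n + 1)) K) :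
    coeffLast K c (MvPolynomial.pderiv (Sum.inr (Fin.last n)) P) =
      ((c.2 : K) + 1) • coeffLast K (c.1, c.2 + 1) P := by
  ext m
  rw [coeff_coeffLast, MvPolynomial.coeff_pderiv, MvPolynomial.coeff_smul, coeff_coeffLast,
    smul_eq_mul, mul_comm, snocExp_inr_last]
  congr 2
  refine exp_ext_last (fun w => ?_) ?_ ?_
  · cases w <;> simp [castVar, Fin.castSucc_ne_last] <;> simp [snocExp]
  · simp
  · simp

/-- Differentiating in the last pair only shifts its exponents; the scalar is a product of positive
integers, nonzero in characteristic `0`. -/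
theorem exists_coeffLast_iterPDeriv_last [CharZero K] (c : ℕ × ℕ) (u v : ℕ) :
    ∃ a : K, a ≠ 0 ∧ ∀ P : MvPolynomial (Var (n + 1)) K,
      coeffLast K c (iterPDeriv (List.replicate u (Sum.inl (Fin.last n)) ++
        List.replicate v (Sum.inr (Fin.last n))) P) = a • coeffLast K (c.1 + u, c.2 + v) P := by
  induction u generalizing c with
  | zero =>
    induction v generalizing c with
    | zero => exact ⟨1, one_ne_zero, fun P => by rw [one_smul]; rfl⟩
    | succ v ih =>
      obtain ⟨a, ha, h⟩ := ih (c.1, c.2 + 1)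
      refine ⟨((c.2 : K) + 1) * a, mul_ne_zero (Nat.cast_add_one_ne_zero _) ha, fun P => ?_⟩
      simp only [List.replicate_zero, List.nil_append] at h ⊢
      rw [List.replicate_succ, iterPDeriv_cons, coeffLast_pderiv_inr_last, h, smul_smul,
        add_assoc c.2 1 v, add_comm 1 v]
  | succ u ih =>
    obtain ⟨a, ha, h⟩ := ih (c.1 + 1, c.2)
    refine ⟨((c.1 : K) + 1) * a, mul_ne_zero (Nat.cast_add_one_ne_zero _) ha, fun P => ?_⟩
    rw [List.replicate_succ, List.cons_append, iterPDeriv_cons, coeffLast_pderiv_inl_last, h,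
      smul_smul, add_assoc c.1 1 u, add_comm 1 u]

theorem weightedHomogeneousComponent_coeffLast (c d : ℕ × ℕ) (P : MvPolynomial (Var (n + 1)) K) :
    MvPolynomial.weightedHomogeneousComponent bideg d (coeffLast K c P) =
      coeffLast K c (MvPolynomial.weightedHomogeneousComponent bideg (d + c) P) := by
  classical
  ext m
  rw [MvPolynomial.coeff_weightedHomogeneousComponent, coeff_coeffLast, coeff_coeffLast,
    MvPolynomial.coeff_weightedHomogeneousComponent, weight_snocExp]
  simp only [add_left_inj]

theorem exists_coeff_of_coeff_iterPDeriv_ne_zero (l : List (Var n)) {P : MvPolynomial (Var n) K}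
    {m : Var n →₀ ℕ} (h : MvPolynomial.coeff m (iterPDeriv l P) ≠ 0) :
    ∃ m', m ≤ m' ∧ MvPolynomial.coeff m' P ≠ 0 := by
  induction l generalizing m with
  | nil => exact ⟨m, le_rfl, h⟩
  | cons v l ih =>
    rw [iterPDeriv_cons, MvPolynomial.coeff_pderiv] at h
    obtain ⟨m', hm', h'⟩ := ih (left_ne_zero_of_mul h)
    exact ⟨m', le_self_add.trans hm', h'⟩

/-- Every monomial of a derivative of `Δ` divides a monomial of `Δ`, in which the last pair of
variables has some `D j` as exponent. -/
theorem coeffLast_eq_zero {D : Fin (n + 1) → ℕ × ℕ} {c : ℕ × ℕ} (hc : ∀ j, ¬ c ≤ D j)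
    {P : MvPolynomial (Var (n + 1)) K} (hP : P ∈ latticeModule K D) : coeffLast K c P = 0 := by
  rw [← LinearMap.mem_ker]
  revert P
  change latticeModule K D ≤ LinearMap.ker (coeffLast K c)
  refine Submodule.span_le.mpr ?_
  rintro _ ⟨l, rfl⟩
  change coeffLast K c (iterPDeriv l (latticeDet K D)) = 0
  ext m
  by_contra hne
  rw [coeff_coeffLast] at hne
  obtain ⟨m', hm', h⟩ := exists_coeff_of_coeff_iterPDeriv_ne_zero l hne
  obtain ⟨σ, rfl⟩ := exists_permExp_of_coeff_ne_zero h
  refine hc (σ (Fin.last n)) ⟨?_, ?_⟩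
  · simpa using hm' (Sum.inl (Fin.last n))
  · simpa using hm' (Sum.inr (Fin.last n))

/-! ### Permutations fixing one point -/

/-- The permutation of `Fin (n + 1)` that fixes `a` and acts as `τ` on the other points. -/
def fixPerm (a : Fin (n + 1)) (τ : Equiv.Perm (Fin n)) : Equiv.Perm (Fin (n + 1)) :=
  τ.extendDomain (finSuccAboveEquiv a)

@[simp] theorem fixPerm_self (a : Fin (n + 1)) (τ : Equiv.Perm (Fin n)) : fixPerm a τ a = a :=
  Equiv.Perm.extendDomain_apply_not_subtype _ _ (by simp)

@[simp] theorem fixPerm_succAbove (a : Fin (n + 1)) (τ : Equiv.Perm (Fin n)) (i : Fin n) :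
    fixPerm a τ (a.succAbove i) = a.succAbove (τ i) := by
  have := Equiv.Perm.extendDomain_apply_image τ (finSuccAboveEquiv a) i
  simpa [finSuccAboveEquiv_apply, fixPerm] using this

@[simp] theorem fixPerm_last_castSucc (τ : Equiv.Perm (Fin n)) (i : Fin n) :
    fixPerm (Fin.last n) τ i.castSucc = (τ i).castSucc := by
  simpa using fixPerm_succAbove (Fin.last n) τ i

theorem fixPerm_injective (a : Fin (n + 1)) :
    Function.Injective (fixPerm a : Equiv.Perm (Fin n) → _) :=
  Equiv.Perm.extendDomainHom_injective (finSuccAboveEquiv a)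

theorem exists_fixPerm {a : Fin (n + 1)} {σ : Equiv.Perm (Fin (n + 1))} (h : σ a = a) :
    ∃ τ, fixPerm a τ = σ := by
  have hσ : ∀ x, σ x ≠ a ↔ x ≠ a := fun x => by
    conv_lhs => rw [← h]
    exact σ.injective.ne_iff
  refine ⟨(finSuccAboveEquiv a).symm.permCongr (σ.subtypePerm hσ), ?_⟩
  ext x : 1
  rcases eq_or_ne x a with rfl | hx
  · rw [fixPerm_self, h]
  · obtain ⟨i, rfl⟩ := Fin.exists_succAbove_eq hx
    rw [fixPerm_succAbove]
    have h1 : ∀ y, a.succAbove ((finSuccAboveEquiv a).symm y) = y := fun y => by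
      have := congrArg Subtype.val ((finSuccAboveEquiv a).apply_symm_apply y)
      rwa [finSuccAboveEquiv_apply] at this
    simp only [Equiv.permCongr_apply, Equiv.symm_symm, h1]
    rfl

theorem sign_fixPerm (a : Fin (n + 1)) (τ : Equiv.Perm (Fin n)) :
    Equiv.Perm.sign (fixPerm a τ) = Equiv.Perm.sign τ :=
  Equiv.Perm.sign_extendDomain τ _

/-- A permutation fixing the last index leaves the last pair of variables alone. This makes the
filtration by these coefficients stable under `S_n`. -/
theorem coeffLast_rename (c : ℕ × ℕ) (τ : Equiv.Perm (Fin n)) (P : MvPolynomial (Var (n + 1)) K) :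
    coeffLast K c (diagAction K (n + 1) (fixPerm (Fin.last n) τ) P) =
      diagAction K n τ (coeffLast K c P) := by
  rw [diagAction_apply, diagAction_apply]
  set f : Var n → Var n := Sum.map τ τ with hf
  set g : Var (n + 1) → Var (n + 1) :=
    Sum.map (fixPerm (Fin.last n) τ) (fixPerm (Fin.last n) τ) with hg
  have hfi : Function.Injective f := Function.Injective.sumMap τ.injective τ.injective
  have hgi : Function.Injective g :=
    Function.Injective.sumMap (Equiv.injective _) (Equiv.injective _)
  have hfs : Function.Surjective f := Finite.surjective_of_injective hfi
  ext m
  obtain ⟨m, rfl⟩ := Finsupp.mapDomain_surjective hfs m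
  rw [coeff_coeffLast, MvPolynomial.coeff_rename_mapDomain _ hfi, coeff_coeffLast,
    ← MvPolynomial.coeff_rename_mapDomain g hgi P (snocExp c m)]
  refine congrArg (fun m => MvPolynomial.coeff m (MvPolynomial.rename g P)) ?_
  have hgl : g (Sum.inl (Fin.last n)) = Sum.inl (Fin.last n) := by simp [hg]
  have hgr : g (Sum.inr (Fin.last n)) = Sum.inr (Fin.last n) := by simp [hg]
  refine exp_ext_last (fun v => ?_) ?_ ?_
  · obtain ⟨v, rfl⟩ := hfs v
    have hgv : castVar (f v) = g (castVar v) := by cases v <;> simp [castVar, hf, hg]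
    rw [snocExp_castVar, Finsupp.mapDomain_apply hfi, hgv, Finsupp.mapDomain_apply hgi,
      snocExp_castVar]
  · rw [snocExp_inl_last]
    conv_rhs => rw [← hgl, Finsupp.mapDomain_apply hgi, snocExp_inl_last]
  · rw [snocExp_inr_last]
    conv_rhs => rw [← hgr, Finsupp.mapDomain_apply hgi, snocExp_inr_last]

/-- Laplace expansion along the last row: as `c` occurs only as last entry, the contributing
permutations are those fixing the last index, and their signs are unchanged on restriction. -/
theorem coeffLast_latticeDet {D : Fin n → ℕ × ℕ} {c : ℕ × ℕ} (hc : ∀ i, D i ≠ c) :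
    coeffLast K c (latticeDet K (Fin.snoc D c : Fin (n + 1) → ℕ × ℕ)) = latticeDet K D := by
  ext m
  rw [coeff_coeffLast, coeff_latticeDet, coeff_latticeDet]
  symm
  refine Fintype.sum_of_injective (fixPerm (Fin.last n)) (fixPerm_injective _) _ _ ?_ ?_
  · intro σ hσ
    refine if_neg fun h => hσ ?_
    refine exists_fixPerm ?_
    have h1 : (Fin.snoc D c : Fin (n + 1) → ℕ × ℕ) (σ (Fin.last n)) = c := by
      ext
      · rw [← permExp_inl, h, snocExp_inl_last]
      · rw [← permExp_inr, h, snocExp_inr_last]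
    generalize σ (Fin.last n) = i at h1 ⊢
    induction i using Fin.lastCases with
    | last => rfl
    | cast i => exact absurd (by simpa using h1) (hc i)
  · intro τ
    have h : permExp (Fin.snoc D c : Fin (n + 1) → ℕ × ℕ) (fixPerm (Fin.last n) τ) =
        snocExp c (permExp D τ) := by
      refine exp_ext_last (fun v => ?_) ?_ ?_
      · rw [snocExp_castVar]
        cases v <;> simp [castVar]
      · simp
      · simp
    rw [h, sign_fixPerm]
    simp only [(snocExp_injective c).eq_iff]

end LastVariables

/-! ### Rectangles: the graded pieces and their characters. -/

section Rectangle

variable {K : Type*} [Field K] {n : ℕ}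

/-! ### The diagonal action on lattice modules -/

theorem diagAction_latticeDet (D : Fin n → ℕ × ℕ) (σ : Equiv.Perm (Fin n)) :
    diagAction K n σ (latticeDet K D) = ((Equiv.Perm.sign σ : ℤ) : K) • latticeDet K D := by
  rw [diagAction_apply, latticeDet, AlgHom.map_det, Int.cast_smul_eq_zsmul, zsmul_eq_mul,
    ← Matrix.det_permute]
  congr 1
  ext1 i j
  simp [Matrix.submatrix]

theorem latticeModule_le_comap (D : Fin n → ℕ × ℕ) (σ : Equiv.Perm (Fin n)) :
    latticeModule K D ≤ (latticeModule K D).comap (diagAction K n σ) := by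
  refine Submodule.span_le.mpr ?_
  rintro _ ⟨l, rfl⟩
  change diagAction K n σ (iterPDeriv l (latticeDet K D)) ∈ latticeModule K D
  rw [diagAction_iterPDeriv, diagAction_latticeDet, ← iterPDerivLin_apply, map_smul,
    iterPDerivLin_apply]
  exact Submodule.smul_mem _ _ (iterPDeriv_mem_latticeModule _ _)

theorem latticePart_le_comap (D : Fin n → ℕ × ℕ) (d : ℕ × ℕ) (σ : Equiv.Perm (Fin n)) :
    latticePart K D d ≤ (latticePart K D d).comap (diagAction K n σ) := fun _ hP =>
  ⟨latticeModule_le_comap D σ hP.1, diagAction_mem_weightedHomogeneous K σ d hP.2⟩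

variable (K) in
/-- The bigraded character of `M_D`. -/
noncomputable def latticeChar (D : Fin n → ℕ × ℕ) (σ : Equiv.Perm (Fin n)) : QT K :=
  ∑ d ∈ Finset.Iic (∑ i, D i), trOn (latticePart K D d) (diagAction K n σ) •
    (t K ^ d.1 * q K ^ d.2)

theorem latticeChar_conj (D : Fin n → ℕ × ℕ) (σ π : Equiv.Perm (Fin n)) :
    latticeChar K D (π * σ * π⁻¹) = latticeChar K D σ := by
  refine Finset.sum_congr rfl fun d _ => ?_
  have h := fun ρ => trOn_eq (latticePart_le_comap (K := K) D d ρ)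
  rw [h, h]
  congr 1
  exact Representation.char_conj
    ((diagAction K n).subrepresentation (latticePart K D d) (latticePart_le_comap D d)) σ π

/-! ### The filtration of the module of a rectangle -/

variable {D : Fin n → ℕ × ℕ} {r s : ℕ}

/-- `D`, followed by `(s - 1, r - 1)`, enumerates the cells of the rectangle with `s` rows of
length `r`. -/
structure EnumeratesRectPred (D : Fin n → ℕ × ℕ) (r s : ℕ) : Prop where
  one_le_left : 1 ≤ r
  one_le_right : 1 ≤ s
  injective : Function.Injective (Fin.snoc D (s - 1, r - 1) : Fin (n + 1) → ℕ × ℕ)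
  mem_range : ∀ c : ℕ × ℕ, c ∈ Set.range (Fin.snoc D (s - 1, r - 1) : Fin (n + 1) → ℕ × ℕ) ↔
    c.1 < s ∧ c.2 < r

variable (K) in
/-- The coefficient of the monomial in `x_n`, `y_n` indexed by the `j`-th cell, row by row, of a
diagram with rows of length `r`. -/
noncomputable def cellCoeff (r j : ℕ) : MvPolynomial (Var (n + 1)) K →ₗ[K] MvPolynomial (Var n) K :=
  coeffLast K (j / r, j % r)

namespace EnumeratesRectPred

variable (hD : EnumeratesRectPred D r s)
include hD

theorem ne_corner (i : Fin n) : D i ≠ (s - 1, r - 1) := by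
  intro h
  have : (Fin.snoc D (s - 1, r - 1) : Fin (n + 1) → ℕ × ℕ) i.castSucc =
      (Fin.snoc D (s - 1, r - 1) : Fin (n + 1) → ℕ × ℕ) (Fin.last n) := by simpa using h
  exact Fin.castSucc_ne_last i (hD.injective this)

theorem not_le {c : ℕ × ℕ} (hc : ¬ (c.1 < s ∧ c.2 < r)) (j : Fin (n + 1)) :
    ¬ c ≤ (Fin.snoc D (s - 1, r - 1) : Fin (n + 1) → ℕ × ℕ) j := by
  intro h
  have := (hD.mem_range _).mp ⟨j, rfl⟩
  exact hc ⟨h.1.trans_lt this.1, h.2.trans_lt this.2⟩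

theorem isLowerSet :
    IsLowerSet (Set.range (Fin.snoc D (s - 1, r - 1) : Fin (n + 1) → ℕ × ℕ)) := by
  intro a b hba ha
  rw [hD.mem_range] at ha ⊢
  exact ⟨hba.1.trans_lt ha.1, hba.2.trans_lt ha.2⟩

theorem image_eq : Finset.univ.image (Fin.snoc D (s - 1, r - 1) : Fin (n + 1) → ℕ × ℕ) =
    Finset.range s ×ˢ Finset.range r := by
  ext c
  rw [Finset.mem_product, Finset.mem_range, Finset.mem_range, ← hD.mem_range]
  simp only [Finset.mem_image, Finset.mem_univ, true_and, Set.mem_range]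

theorem card_eq : n + 1 = s * r := by
  have := congrArg Finset.card hD.image_eq
  rwa [Finset.card_image_of_injective _ hD.injective, Finset.card_univ, Fintype.card_fin,
    Finset.card_product, Finset.card_range, Finset.card_range] at this

theorem cell_lt {j : ℕ} (hj : j < n + 1) : j / r < s ∧ j % r < r := by
  rw [hD.card_eq] at hj
  exact ⟨Nat.div_lt_of_lt_mul (by rwa [mul_comm]), Nat.mod_lt _ hD.one_le_left⟩

theorem cellCoeff_eq_zero {P : MvPolynomial (Var (n + 1)) K}
    (hP : P ∈ latticeModule K (Fin.snoc D (s - 1, r - 1) : Fin (n + 1) → ℕ × ℕ)) {j : ℕ}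
    (hj : n + 1 ≤ j) : cellCoeff K r j P = 0 := by
  refine coeffLast_eq_zero (hD.not_le fun h => ?_) hP
  rw [hD.card_eq] at hj
  exact absurd ((Nat.le_div_iff_mul_le hD.one_le_left).mpr hj) (_root_.not_le.mpr h.1)

theorem eq_zero_of_cellCoeff {P : MvPolynomial (Var (n + 1)) K}
    (hP : P ∈ latticeModule K (Fin.snoc D (s - 1, r - 1) : Fin (n + 1) → ℕ × ℕ))
    (h : ∀ j, cellCoeff K r j P = 0) : P = 0 := by
  refine eq_zero_of_coeffLast fun c => ?_
  by_cases hc : c.2 < r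
  -- This is the row-by-row position of `c`. The cells with `c.2 ≥ r`, which have no position, lie
  -- outside the rectangle.
  · have := h (c.2 + r * c.1)
    rwa [cellCoeff, Nat.add_mul_div_left _ _ hD.one_le_left, Nat.div_eq_of_lt hc,
      Nat.add_mul_mod_self_left, Nat.mod_eq_of_lt hc, zero_add] at this
  · exact coeffLast_eq_zero (hD.not_le fun h => hc h.2) hP

/-- Every graded piece of the filtration of the module of the rectangle contains `M_D`. -/
theorem latticeModule_le_map_flag [CharZero K] {j : ℕ} (hj : j < n + 1) :
    latticeModule K D ≤
      (flag (latticeModule K (Fin.snoc D (s - 1, r - 1) : Fin (n + 1) → ℕ × ℕ)) (cellCoeff K r)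
        (j + 1)).map (cellCoeff K r j) := by
  obtain ⟨ha, hb⟩ := hD.cell_lt hj
  refine Submodule.span_le.mpr ?_
  rintro _ ⟨l, rfl⟩
  set D' : Fin (n + 1) → ℕ × ℕ := Fin.snoc D (s - 1, r - 1) with hD'
  -- These orders of differentiation bring the corner exponent `(s - 1, r - 1)` down to the cell
  -- `j`.
  set u := s - 1 - j / r with hu
  set v := r - 1 - j % r with hv
  set w : List (Var (n + 1)) := List.replicate u (Sum.inl (Fin.last n)) ++
    List.replicate v (Sum.inr (Fin.last n)) with hw
  set P := iterPDeriv (l.map castVar) (iterPDeriv w (latticeDet K D')) with hP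
  have hmem : P ∈ flag (latticeModule K D') (cellCoeff K r) (j + 1) := by
    refine mem_flag.mpr ⟨iterPDeriv_mem_latticeModule_of_mem _ _
      (iterPDeriv_mem_latticeModule _ _), fun i hi => ?_⟩
    rw [cellCoeff, hP, coeffLast_iterPDeriv_castVar]
    obtain ⟨a, -, h⟩ := exists_coeffLast_iterPDeriv_last (K := K) (n := n) (i / r, i % r) u v
    rw [h, coeffLast_eq_zero (D := D') ?_ (latticeDet_mem_latticeModule D'), smul_zero,
      ← iterPDerivLin_apply, map_zero]
    -- If the shifted cell of `i` were still in the rectangle, `i` would lie weakly above and to the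
    -- left of `j`, hence `i ≤ j` in reading order, against `j + 1 ≤ i`.
    refine hD.not_le fun hlt => ?_
    have h1 : i / r ≤ j / r := by have := hlt.1; dsimp only at this; omega
    have h2 : i % r ≤ j % r := by have := hlt.2; dsimp only at this; omega
    have h3 := Nat.div_add_mod i r
    have h4 := Nat.div_add_mod j r
    have h5 := Nat.mul_le_mul_left r h1
    omega
  obtain ⟨a, ha0, h⟩ := exists_coeffLast_iterPDeriv_last (K := K) (n := n) (j / r, j % r) u v
  have hval : cellCoeff K r j P = a • iterPDeriv l (latticeDet K D) := by
    have h1 : ((j / r, j % r).1 + u, (j / r, j % r).2 + v) = (s - 1, r - 1) := by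
      exact Prod.ext (Nat.add_sub_of_le (Nat.le_sub_one_of_lt ha))
        (Nat.add_sub_of_le (Nat.le_sub_one_of_lt hb))
    rw [cellCoeff, hP, coeffLast_iterPDeriv_castVar, h, h1, hD',
      coeffLast_latticeDet hD.ne_corner, ← iterPDerivLin_apply, map_smul, iterPDerivLin_apply]
  refine (Submodule.smul_mem_iff _ ha0).mp ?_
  rw [← hval]
  exact Submodule.mem_map_of_mem hmem

/-- The squeeze: `n + 1` pieces, each of dimension at least `n!`, in a space of dimension at most
`(n + 1)!`. -/
theorem finite_and_map_flag_eq [CharZero K]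
    (hfac : Module.finrank K (latticeModule K D) = n.factorial) :
    Module.Finite K (latticeModule K (Fin.snoc D (s - 1, r - 1) : Fin (n + 1) → ℕ × ℕ)) ∧
    Module.finrank K (latticeModule K (Fin.snoc D (s - 1, r - 1) : Fin (n + 1) → ℕ × ℕ)) =
      (n + 1).factorial ∧
    ∀ j < n + 1, (flag (latticeModule K (Fin.snoc D (s - 1, r - 1) : Fin (n + 1) → ℕ × ℕ))
      (cellCoeff K r) (j + 1)).map (cellCoeff K r j) = latticeModule K D := by
  obtain ⟨hfin, hle⟩ := finite_latticeModule_and_finrank_le (K := K) hD.injective hD.isLowerSet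
  have := map_flag_eq (n + 1) (fun P hP j hj => hD.cellCoeff_eq_zero hP hj)
    (fun P hP h => hD.eq_zero_of_cellCoeff hP h) (latticeModule K D)
    (fun j hj => hD.latticeModule_le_map_flag hj)
    (by rw [hfac, ← Nat.factorial_succ]; exact hle)
  rw [hfac, ← Nat.factorial_succ] at this
  exact ⟨hfin, this⟩

theorem map_flag_latticePart [CharZero K]
    (hfac : Module.finrank K (latticeModule K D) = n.factorial) (d : ℕ × ℕ) {j : ℕ}
    (hj : j < n + 1) :
    (flag (latticePart K (Fin.snoc D (s - 1, r - 1) : Fin (n + 1) → ℕ × ℕ) d)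
      (cellCoeff K r) (j + 1)).map (cellCoeff K r j) =
      if (j / r, j % r) ≤ d then latticePart K D (d - (j / r, j % r)) else ⊥ := by
  have hmap := (hD.finite_and_map_flag_eq hfac).2.2 j hj
  refine le_antisymm ?_ ?_
  · rintro _ ⟨P, hP, rfl⟩
    obtain ⟨hP1, hP2⟩ := mem_flag.mp hP
    have hmem : cellCoeff K r j P ∈ latticeModule K D := by
      rw [← hmap]
      exact Submodule.mem_map_of_mem (mem_flag.mpr ⟨hP1.1, hP2⟩)
    have hw : ∀ m, MvPolynomial.coeff m (cellCoeff K r j P) ≠ 0 →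
        Finsupp.weight bideg m + (j / r, j % r) = d := by
      intro m hm
      rw [← weight_snocExp]
      exact hP1.2 hm
    split_ifs with h
    · refine ⟨hmem, fun m hm => ?_⟩
      rw [← hw m hm, add_tsub_cancel_right]
    · rw [Submodule.mem_bot]
      ext m
      by_contra hm
      exact h (by rw [← hw m hm]; exact le_add_self)
  · split_ifs with h
    · intro f hf
      -- A lift of `f` exists without regard to degree. Its component of bidegree `d` is still a
      -- lift, since taking coefficients commutes with taking components up to the shift by the
      -- cell.
      obtain ⟨P, hP, hPf⟩ := hmap.ge hf.1
      obtain ⟨hP1, hP2⟩ := mem_flag.mp hP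
      refine ⟨MvPolynomial.weightedHomogeneousComponent bideg d P, mem_flag.mpr
        ⟨weightedHomogeneousComponent_mem_latticePart hP1 d, fun i hi => ?_⟩, ?_⟩
      -- When the cell of `i` is not below `d`, its coefficient in a polynomial of bidegree `d`
      -- vanishes for degree reasons.
      · by_cases hi' : (i / r, i % r) ≤ d
        · have h0 := weightedHomogeneousComponent_coeffLast (i / r, i % r) (d - (i / r, i % r)) P
          rw [tsub_add_cancel_of_le hi'] at h0
          rw [cellCoeff, ← h0]
          have := hP2 i hi
          rw [cellCoeff] at this
          rw [this, map_zero]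
        · ext m
          by_contra hm
          refine hi' ?_
          rw [← MvPolynomial.weightedHomogeneousComponent_isWeightedHomogeneous d P hm,
            weight_snocExp]
          exact le_add_self
      · have h0 := weightedHomogeneousComponent_coeffLast (j / r, j % r) (d - (j / r, j % r)) P
        rw [tsub_add_cancel_of_le h] at h0
        rw [cellCoeff] at hPf ⊢
        rw [← h0, hPf]
        exact MvPolynomial.IsWeightedHomogeneous.weightedHomogeneousComponent_same hf.2
    · exact bot_le

theorem trOn_latticePart [CharZero K]
    (hfac : Module.finrank K (latticeModule K D) = n.factorial) (d : ℕ × ℕ)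
    (τ : Equiv.Perm (Fin n)) :
    trOn (latticePart K (Fin.snoc D (s - 1, r - 1) : Fin (n + 1) → ℕ × ℕ) d)
      (diagAction K (n + 1) (fixPerm (Fin.last n) τ)) =
      ∑ j ∈ Finset.range (n + 1), if (j / r, j % r) ≤ d then
        trOn (latticePart K D (d - (j / r, j % r))) (diagAction K n τ) else 0 := by
  have := (hD.finite_and_map_flag_eq hfac).1
  have : Module.Finite K
      (latticePart K (Fin.snoc D (s - 1, r - 1) : Fin (n + 1) → ℕ × ℕ) d) :=
    Module.Finite.of_injective (Submodule.inclusion (inf_le_left : latticePart K _ d ≤ _))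
      (Submodule.inclusion_injective _)
  rw [trOn_eq_sum_flag (latticePart_le_comap _ _ _) (c := cellCoeff K r)
    (fun j P => coeffLast_rename _ τ P) (n + 1) (fun P hP j hj => hD.cellCoeff_eq_zero hP.1 hj)
    (fun P hP h => hD.eq_zero_of_cellCoeff hP.1 h)]
  refine Finset.sum_congr rfl fun j hj => ?_
  rw [hD.map_flag_latticePart hfac d (Finset.mem_range.mp hj)]
  split_ifs
  exacts [rfl, trOn_bot _]

theorem latticeChar_fixPerm [CharZero K]
    (hfac : Module.finrank K (latticeModule K D) = n.factorial) (τ : Equiv.Perm (Fin n)) :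
    latticeChar K (Fin.snoc D (s - 1, r - 1) : Fin (n + 1) → ℕ × ℕ) (fixPerm (Fin.last n) τ) =
      (∑ j ∈ Finset.range (n + 1), t K ^ (j / r) * q K ^ (j % r)) * latticeChar K D τ := by
  rw [latticeChar, Finset.sum_mul]
  simp only [hD.trOn_latticePart hfac, Finset.sum_smul]
  rw [Finset.sum_comm]
  refine Finset.sum_congr rfl fun j hj => ?_
  obtain ⟨ha, hb⟩ := hD.cell_lt (Finset.mem_range.mp hj)
  set c : ℕ × ℕ := (j / r, j % r) with hc
  have hcorner : c ≤ (s - 1, r - 1) := ⟨Nat.le_sub_one_of_lt ha, Nat.le_sub_one_of_lt hb⟩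
  have hsum : ∑ i, (Fin.snoc D (s - 1, r - 1) : Fin (n + 1) → ℕ × ℕ) i =
      ∑ i, D i + (s - 1, r - 1) := by
    rw [Fin.sum_univ_castSucc]
    simp
  rw [latticeChar, Finset.mul_sum]
  symm
  -- For a fixed cell `c`, bidegree `e` of `M_D` contributes in bidegree `e + c`. The bidegrees
  -- missed by this shift carry a zero component or have `c ≰ d`.
  refine Finset.sum_of_injOn (fun e => e + c) (fun _ _ _ _ h => add_right_cancel h) ?_ ?_ ?_
  · intro e he
    rw [Finset.mem_coe, Finset.mem_Iic] at he ⊢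
    rw [hsum]
    exact add_le_add he hcorner
  · intro d _ hd
    split_ifs with h
    · rw [latticePart_eq_bot, trOn_bot, zero_smul]
      intro hle
      exact hd ⟨d - c, Finset.mem_coe.mpr (Finset.mem_Iic.mpr hle), tsub_add_cancel_of_le h⟩
    · exact zero_smul _ _
  · intro e _
    rw [if_pos le_add_self, add_tsub_cancel_right, mul_smul_comm]
    congr 1
    rw [Prod.fst_add, Prod.snd_add, pow_add, pow_add, hc]
    ring

end EnumeratesRectPred

end Rectangle

/-! ### Frobenius characteristics and the passage to partitions. -/

section Frobenius

variable {K : Type*} [Field K] {n : ℕ}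

/-! ### The derivative of a Frobenius characteristic -/

theorem pShape_eq (σ : Equiv.Perm (Fin n)) :
    pShape K σ = (σ.cycleType.map (p K)).prod * p K 1 ^ (n - σ.support.card) := by
  rw [pShape, Equiv.Perm.parts_partition, Multiset.map_add, Multiset.prod_add,
    Multiset.map_replicate, Multiset.prod_replicate, Fintype.card_fin]

theorem dp1_pow_p_one (k : ℕ) : dp1 K (p K 1 ^ k) = (k : SymFun K) * p K 1 ^ (k - 1) := by
  have h : p K 1 = MvPolynomial.X 1 := rfl
  rw [dp1, h, MvPolynomial.pderiv_pow, MvPolynomial.pderiv_X_self, mul_one]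

theorem dp1_p_of_one_lt {k : ℕ} (hk : 1 < k) : dp1 K (p K k) = 0 := by
  refine MvPolynomial.pderiv_X_of_ne fun h => ?_
  have := congrArg PNat.val h
  rw [Nat.toPNat'_coe, if_pos (by omega)] at this
  exact hk.ne' this

/-- `cycleType` omits fixed points, so `p_1` does not occur in this product. -/
theorem dp1_prod_cycleType (σ : Equiv.Perm (Fin n)) :
    dp1 K (σ.cycleType.map (p K)).prod = 0 := by
  have h : ∀ k ∈ σ.cycleType, 1 < k := fun k hk => Equiv.Perm.one_lt_of_mem_cycleType hk
  revert h
  induction σ.cycleType using Multiset.induction_on with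
  | empty =>
    intro _
    exact MvPolynomial.pderiv_one
  | cons k m ih =>
    intro h
    have h1 := ih fun j hj => h j (Multiset.mem_cons_of_mem hj)
    have h2 := dp1_p_of_one_lt (K := K) (h k (Multiset.mem_cons_self k m))
    rw [dp1] at h1 h2 ⊢
    rw [Multiset.map_cons, Multiset.prod_cons, MvPolynomial.pderiv_mul, h1, h2, mul_zero, zero_mul,
      add_zero]

/-- The exponent of `p_1` is the number of fixed points. Writing this factor as a sum over them
prepares the exchange of sums in `dp1_frobenius`. -/
theorem dp1_pShape (σ : Equiv.Perm (Fin n)) :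
    dp1 K (pShape K σ) = ∑ a : Fin n, if σ a = a then
      (σ.cycleType.map (p K)).prod * p K 1 ^ (n - σ.support.card - 1) else 0 := by
  have h1 := dp1_prod_cycleType (K := K) σ
  have h2 := dp1_pow_p_one (K := K) (n - σ.support.card)
  have hcard : (Finset.univ.filter fun a => σ a = a).card = n - σ.support.card := by
    have h : (Finset.univ.filter fun a => σ a = a) = σ.supportᶜ := by
      ext a
      simp
    rw [h, Finset.card_compl, Fintype.card_fin]
  rw [dp1] at h1 h2 ⊢
  rw [pShape_eq, MvPolynomial.pderiv_mul, h1, h2, zero_mul, zero_add, ← Finset.sum_filter,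
    Finset.sum_const, hcard, nsmul_eq_mul]
  ring

theorem pShape_fixPerm (a : Fin (n + 1)) (τ : Equiv.Perm (Fin n)) :
    ((fixPerm a τ).cycleType.map (p K)).prod *
      p K 1 ^ (n + 1 - (fixPerm a τ).support.card - 1) = pShape K τ := by
  have h1 : (fixPerm a τ).cycleType = τ.cycleType := Equiv.Perm.cycleType_extendDomain _
  rw [pShape_eq, ← Equiv.Perm.sum_cycleType, ← Equiv.Perm.sum_cycleType, h1]
  congr 2
  omega

theorem exists_conj_fixPerm (a : Fin (n + 1)) (τ : Equiv.Perm (Fin n)) :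
    ∃ π : Equiv.Perm (Fin (n + 1)), π * fixPerm (Fin.last n) τ * π⁻¹ = fixPerm a τ := by
  rw [← isConj_iff, Equiv.Perm.isConj_iff_cycleType_eq]
  exact (Equiv.Perm.cycleType_extendDomain _).trans (Equiv.Perm.cycleType_extendDomain _).symm

/-- `∂_{p_1}` of the Frobenius characteristic of a class function on `S_{n+1}` is the Frobenius
characteristic of its restriction to `S_n`. -/
theorem dp1_frobenius [CharZero K] (χ : Equiv.Perm (Fin (n + 1)) → QT K)
    (hχ : ∀ σ π, χ (π * σ * π⁻¹) = χ σ) :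
    dp1 K (((n + 1).factorial : K)⁻¹ • ∑ σ, χ σ • pShape K σ) =
      ((n.factorial : K)⁻¹) • ∑ τ, χ (fixPerm (Fin.last n) τ) • pShape K τ := by
  have hlin : dp1 K (((n + 1).factorial : K)⁻¹ • ∑ σ, χ σ • pShape K σ) =
      ((n + 1).factorial : K)⁻¹ • ∑ σ, χ σ • dp1 K (pShape K σ) := by
    simp only [dp1]
    rw [← algebraMap_smul (QT K), Derivation.map_smul, algebraMap_smul, map_sum]
    simp only [Derivation.map_smul]
  -- Pairs of a permutation and a fixed point `a` correspond to pairs `(a, τ)` with `τ ∈ S_n`. As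
  -- `χ` is a class function, each `a` contributes as much as the last index, and the resulting
  -- factor `n + 1` turns `1/(n + 1)!` into `1/n!`.
  have hsum : ∑ σ, χ σ • dp1 K (pShape K σ) =
      ∑ a : Fin (n + 1), ∑ τ, χ (fixPerm (Fin.last n) τ) • pShape K τ := by
    simp only [dp1_pShape, Finset.smul_sum]
    rw [Finset.sum_comm]
    refine Finset.sum_congr rfl fun a _ => ?_
    symm
    refine Fintype.sum_of_injective (fixPerm a) (fixPerm_injective a) _ _ ?_ ?_
    · intro σ hσ
      rw [if_neg fun h => hσ (exists_fixPerm h), smul_zero]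
    · intro τ
      obtain ⟨π, hπ⟩ := exists_conj_fixPerm a τ
      rw [if_pos (fixPerm_self a τ), pShape_fixPerm, ← hπ, hχ]
  rw [hlin, hsum, Finset.sum_const, Finset.card_univ, Fintype.card_fin, ← Nat.cast_smul_eq_nsmul K,
    smul_smul, Nat.factorial_succ]
  congr 1
  have h1 : ((n + 1 : ℕ) : K) ≠ 0 := Nat.cast_ne_zero.mpr n.succ_ne_zero
  have h2 : (n.factorial : K) ≠ 0 := Nat.cast_ne_zero.mpr n.factorial_ne_zero
  push_cast at h1 ⊢
  field_simp

/-! ### The modules of partitions as lattice modules -/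

variable (K) in
/-- The Frobenius characteristic of `M_D`. -/
noncomputable def latticeFrob (D : Fin n → ℕ × ℕ) : SymFun K :=
  ((n.factorial : K)⁻¹) • ∑ σ : Equiv.Perm (Fin n), latticeChar K D σ • pShape K σ

theorem sum_biexp {M : Type*} [AddCommMonoid M] (μ : YoungDiagram) (f : ℕ × ℕ → M) :
    ∑ k, f (biexp μ k) = ∑ c ∈ μ.cells, f c := by
  have hcard : (μ.cells.map toLex.toEmbedding).card = μ.card := Finset.card_map _
  refine Eq.trans ?_ (Finset.sum_map μ.cells toLex.toEmbedding fun c => f (ofLex c))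
  rw [← Finset.map_orderEmbOfFin_univ _ hcard, Finset.sum_map]
  rfl

theorem sum_biexp_eq (μ : YoungDiagram) : ∑ k, biexp μ k = (xDeg μ, yDeg μ) := by
  rw [sum_biexp μ fun c => c, xDeg, yDeg]
  ext
  · rw [Prod.fst_sum]
  · rw [Prod.snd_sum]

theorem biexp_mem (μ : YoungDiagram) (k : Fin μ.card) : biexp μ k ∈ μ := by
  have := Finset.orderEmbOfFin_mem (μ.cells.map toLex.toEmbedding) (Finset.card_map _) k
  rw [Finset.mem_map] at this
  obtain ⟨c, hc, h⟩ := this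
  rw [biexp, ← h]
  exact hc

theorem mem_range_biexp {μ : YoungDiagram} {c : ℕ × ℕ} : c ∈ Set.range (biexp μ) ↔ c ∈ μ := by
  refine ⟨?_, fun hc => ?_⟩
  · rintro ⟨k, rfl⟩
    exact biexp_mem μ k
  · have h : toLex c ∈ ((μ.cells.map toLex.toEmbedding : Finset _) : Set (ℕ ×ₗ ℕ)) :=
      Finset.mem_map_of_mem toLex.toEmbedding hc
    rw [← Finset.range_orderEmbOfFin _ (Finset.card_map _)] at h
    obtain ⟨k, hk⟩ := h
    exact ⟨k, congrArg ofLex hk⟩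

theorem biexp_strictMono (μ : YoungDiagram) : StrictMono fun k => toLex (biexp μ k) :=
  ((μ.cells.map toLex.toEmbedding).orderEmbOfFin (Finset.card_map _)).strictMono

theorem sum_Iic_sum_biexp {M : Type*} [AddCommMonoid M] (μ : YoungDiagram) (f : ℕ × ℕ → M) :
    ∑ d ∈ Finset.Iic (∑ k, biexp μ k), f d =
      ∑ h ∈ Finset.range (xDeg μ + 1), ∑ k ∈ Finset.range (yDeg μ + 1), f (h, k) := by
  rw [sum_biexp_eq, ← Finset.sum_product']
  refine Finset.sum_congr ?_ fun _ _ => rfl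
  ext d
  simp [Prod.le_def]

theorem bigradedChar_eq (μ : YoungDiagram) (σ : Equiv.Perm (Fin μ.card)) :
    bigradedChar K μ σ = latticeChar K (biexp μ) σ := by
  rw [latticeChar, sum_Iic_sum_biexp]
  refine Finset.sum_congr rfl fun h _ => Finset.sum_congr rfl fun k _ => ?_
  rw [trOn_eq (latticePart_le_comap _ _ _)]
  rfl

theorem frobChar_eq {μ : YoungDiagram} (h : n = μ.card) :
    frobChar K μ = latticeFrob K (biexp μ ∘ Fin.cast h) := by
  subst h
  simp only [frobChar, bigradedChar_eq]
  rfl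

theorem hilbertSeries_eq {μ : YoungDiagram} (h : n = μ.card)
    [Module.Finite K (latticeModule K (biexp μ ∘ Fin.cast h))] :
    hilbertSeries K μ = latticeChar K (biexp μ ∘ Fin.cast h) 1 := by
  subst h
  change _ = latticeChar K (biexp μ) 1
  have hfin : Module.Finite K (latticeModule K (biexp μ)) := ‹_›
  rw [latticeChar, sum_Iic_sum_biexp]
  refine Finset.sum_congr rfl fun h _ => Finset.sum_congr rfl fun k _ => ?_
  have : Module.Finite K (latticePart K (biexp μ) (h, k)) :=
    Module.Finite.of_injective (Submodule.inclusion (inf_le_left : latticePart K _ (h, k) ≤ _))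
      (Submodule.inclusion_injective _)
  rw [map_one, Module.End.one_eq_id, trOn_id, Nat.cast_smul_eq_nsmul, nsmul_eq_mul]
  rfl

theorem nFactorialConjecture_iff {μ : YoungDiagram} (h : n = μ.card) :
    NFactorialConjecture K μ ↔
      Module.finrank K (latticeModule K (biexp μ ∘ Fin.cast h)) = n.factorial := by
  subst h
  rfl

/-! ### Rectangles -/

variable {r s : ℕ}

theorem mem_rect {c : ℕ × ℕ} : c ∈ rect r s ↔ c.1 < s ∧ c.2 < r := by
  rw [rect, YoungDiagram.mem_ofRowLens]
  simp

theorem mem_rectPred (hr : 1 ≤ r) (hs : 1 ≤ s) {c : ℕ × ℕ} :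
    c ∈ rectPred r s ↔ (c.1 < s ∧ c.2 < r) ∧ c ≠ (s - 1, r - 1) := by
  rw [rectPred, YoungDiagram.mem_ofRowLens]
  obtain ⟨i, j⟩ := c
  simp only [List.length_append, List.length_replicate, List.length_singleton,
    List.getElem_append, List.getElem_replicate, List.getElem_singleton, ne_eq, Prod.mk.injEq]
  constructor
  · rintro ⟨h1, h2⟩
    split_ifs at h2 <;> omega
  · rintro ⟨⟨h1, h2⟩, h3⟩
    refine ⟨by omega, ?_⟩
    split_ifs <;> omega

theorem cells_rect (hr : 1 ≤ r) (hs : 1 ≤ s) :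
    (rect r s).cells = insert (s - 1, r - 1) (rectPred r s).cells := by
  ext c
  rw [Finset.mem_insert, YoungDiagram.mem_cells, YoungDiagram.mem_cells, mem_rect,
    mem_rectPred hr hs]
  by_cases h : c = (s - 1, r - 1)
  · subst h
    simp only [true_or, iff_true]
    omega
  · simp [h]

theorem card_rect (hr : 1 ≤ r) (hs : 1 ≤ s) : (rectPred r s).card + 1 = (rect r s).card := by
  rw [YoungDiagram.card, YoungDiagram.card, cells_rect hr hs, Finset.card_insert_of_notMem]
  rw [YoungDiagram.mem_cells, mem_rectPred hr hs]
  exact fun h => h.2 rfl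

/-- The corner is the lexicographically largest cell, so appending it keeps the list increasing; the
increasing enumeration of a finite set is unique. -/
theorem biexp_rect (hr : 1 ≤ r) (hs : 1 ≤ s) :
    biexp (rect r s) ∘ Fin.cast (card_rect hr hs) =
      (Fin.snoc (biexp (rectPred r s)) (s - 1, r - 1) :
        Fin ((rectPred r s).card + 1) → ℕ × ℕ) := by
  set f : Fin ((rectPred r s).card + 1) → ℕ × ℕ :=
    Fin.snoc (biexp (rectPred r s)) (s - 1, r - 1) with hf
  have hcard : ((rect r s).cells.map toLex.toEmbedding).card = (rect r s).card :=
    Finset.card_map _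
  have hmem : ∀ k, toLex (f (Fin.cast (card_rect hr hs).symm k)) ∈
      (rect r s).cells.map toLex.toEmbedding := by
    intro k
    refine Finset.mem_map_of_mem toLex.toEmbedding ?_
    generalize Fin.cast (card_rect hr hs).symm k = i
    rw [cells_rect hr hs, Finset.mem_insert]
    induction i using Fin.lastCases with
    | last => left; simp [hf]
    | cast i =>
      right
      rw [hf, Fin.snoc_castSucc]
      exact biexp_mem _ i
  have hmono : StrictMono fun k => toLex (f (Fin.cast (card_rect hr hs).symm k)) := by
    have hf' : StrictMono fun k => toLex (f k) := by
      intro i j hij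
      induction i using Fin.lastCases with
      | last => exact absurd hij (not_lt.mpr (Fin.le_last j))
      | cast i =>
        induction j using Fin.lastCases with
        | last =>
          obtain ⟨⟨h1, h2⟩, h3⟩ := (mem_rectPred hr hs).mp (biexp_mem _ i)
          simp only [hf, Fin.snoc_castSucc, Fin.snoc_last]
          rw [Prod.Lex.toLex_lt_toLex]
          rw [ne_eq, Prod.ext_iff] at h3
          dsimp only at h3 ⊢
          omega
        | cast j =>
          simp only [hf, Fin.snoc_castSucc]
          exact biexp_strictMono _ (Fin.castSucc_lt_castSucc_iff.mp hij)
    exact hf'.comp (Fin.cast_strictMono _)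
  have h := Finset.orderEmbOfFin_unique hcard hmem hmono
  funext k
  have := congrFun h (Fin.cast (card_rect hr hs) k)
  exact (congrArg ofLex this).symm

theorem enumeratesRectPred (hr : 1 ≤ r) (hs : 1 ≤ s) :
    EnumeratesRectPred (biexp (rectPred r s)) r s where
  one_le_left := hr
  one_le_right := hs
  injective := by
    rw [← biexp_rect hr hs]
    refine Function.Injective.comp ?_ (Fin.cast_injective _)
    exact (biexp_strictMono _).injective.of_comp (f := toLex)
  mem_range c := by
    rw [← biexp_rect hr hs, ← mem_rect, ← mem_range_biexp]
    exact iff_of_eq (congrArg (c ∈ ·) ((finCongr (card_rect hr hs)).surjective.range_comp _))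

theorem B_rect (hr : 1 ≤ r) (hs : 1 ≤ s) :
    B K (rect r s) =
      ∑ j ∈ Finset.range ((rectPred r s).card + 1), t K ^ (j / r) * q K ^ (j % r) := by
  have hD := enumeratesRectPred hr hs
  symm
  refine Finset.sum_nbij (fun j => (j / r, j % r)) ?_ ?_ ?_ fun _ _ => rfl
  · intro j hj
    exact mem_rect.mpr (hD.cell_lt (Finset.mem_range.mp hj))
  · intro i _ j _ h
    have h1 := congrArg Prod.fst h
    have h2 := congrArg Prod.snd h
    dsimp only at h1 h2
    rw [← Nat.div_add_mod i r, ← Nat.div_add_mod j r, h1, h2]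
  · intro c hc
    obtain ⟨h1, h2⟩ := mem_rect.mp hc
    refine ⟨c.2 + r * c.1, ?_, ?_⟩
    · rw [Finset.mem_coe, Finset.mem_range, hD.card_eq]
      calc c.2 + r * c.1 < r + r * c.1 := by omega
        _ = (c.1 + 1) * r := by ring
        _ ≤ s * r := Nat.mul_le_mul_right r h1
    · dsimp only
      rw [Nat.add_mul_div_left _ _ (by omega), Nat.div_eq_of_lt h2, Nat.add_mul_mod_self_left,
        Nat.mod_eq_of_lt h2, zero_add]

theorem dp1_latticeFrob [CharZero K] {D : Fin n → ℕ × ℕ} (hD : EnumeratesRectPred D r s)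
    (hfac : Module.finrank K (latticeModule K D) = n.factorial) :
    dp1 K (latticeFrob K (Fin.snoc D (s - 1, r - 1) : Fin (n + 1) → ℕ × ℕ)) =
      (∑ j ∈ Finset.range (n + 1), t K ^ (j / r) * q K ^ (j % r)) • latticeFrob K D := by
  rw [latticeFrob, dp1_frobenius _ (latticeChar_conj _), latticeFrob]
  simp only [hD.latticeChar_fixPerm hfac, mul_smul, ← Finset.smul_sum]
  rw [smul_comm]

theorem iterate_dp1_smul (k : ℕ) (b : QT K) (f : SymFun K) :
    (dp1 K)^[k] (b • f) = b • (dp1 K)^[k] f := by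
  induction k generalizing f with
  | zero => rfl
  | succ k ih =>
    have : dp1 K (b • f) = b • dp1 K f := Derivation.map_smul _ _ _
    rw [Function.iterate_succ_apply, Function.iterate_succ_apply, this, ih]

end Frobenius
end GarsiaHaiman

open GarsiaHaiman in
theorem theorem1p1 (K : Type*) [Field K] [CharZero K] (r s : ℕ) (hr : 1 ≤ r) (hs : 1 ≤ s)
    (hn : GarsiaHaiman.NFactorialConjecture K (GarsiaHaiman.rectPred r s)) :
    GarsiaHaiman.NFactorialConjecture K (GarsiaHaiman.rect r s) ∧
    GarsiaHaiman.dp1 K (GarsiaHaiman.frobChar K (GarsiaHaiman.rect r s)) =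
      GarsiaHaiman.B K (GarsiaHaiman.rect r s) •
        GarsiaHaiman.frobChar K (GarsiaHaiman.rectPred r s) ∧
    GarsiaHaiman.G K (GarsiaHaiman.rect r s) =
      GarsiaHaiman.B K (GarsiaHaiman.rect r s) *
        GarsiaHaiman.G K (GarsiaHaiman.rectPred r s) ∧
    GarsiaHaiman.hilbertSeries K (GarsiaHaiman.rect r s) =
      GarsiaHaiman.B K (GarsiaHaiman.rect r s) *
        GarsiaHaiman.hilbertSeries K (GarsiaHaiman.rectPred r s) := by
  have hD := enumeratesRectPred hr hs
  have hcard := card_rect hr hs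
  obtain ⟨hfin, hdim, -⟩ := hD.finite_and_map_flag_eq hn
  have hfrob : dp1 K (frobChar K (rect r s)) = B K (rect r s) • frobChar K (rectPred r s) := by
    rw [frobChar_eq hcard, biexp_rect hr hs, frobChar_eq rfl, B_rect hr hs]
    exact dp1_latticeFrob hD hn
  refine ⟨?_, hfrob, ?_, ?_⟩
  · rw [nFactorialConjecture_iff hcard, biexp_rect hr hs]
    exact hdim
  -- One of the `n + 1` derivatives is spent on the identity `hfrob`; the other `n` pass through
  -- `B`, which is a scalar for `∂_{p_1}`.
  · rw [G, G, ← hcard, Function.iterate_succ_apply, hfrob, iterate_dp1_smul,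
      MvPolynomial.constantCoeff_smul, smul_eq_mul]
  · have hfin' : Module.Finite K (latticeModule K (biexp (rectPred r s) ∘ Fin.cast rfl)) :=
      Module.finite_of_finrank_pos (by
        rw [(nFactorialConjecture_iff rfl).mp hn]; exact Nat.factorial_pos _)
    rw [← biexp_rect hr hs] at hfin
    -- The identity of `S_{n+1}` comes from that of `S_n`, so the Hilbert series identity is the
    -- character identity at `1`.
    have hone : fixPerm (Fin.last (rectPred r s).card) 1 = 1 := Equiv.Perm.extendDomain_one _
    rw [hilbertSeries_eq hcard, hilbertSeries_eq (μ := rectPred r s) rfl, biexp_rect hr hs,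
      B_rect hr hs, ← hone]
    exact hD.latticeChar_fixPerm hn 1
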